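/- **Invariance of the index bundle under compact perturbations.** Let $\mathbb K\in\{\mathbb R,\mathbb C\}$, let $X$ be a compact Hausdorff space, and let $\mathcal E,\mathcal F$ be $\mathbb K$-Banach bundles over $X$, i.e. locally trivial bundles, each with a Banach space as model fibre, whose transition functions are norm continuous. A morphism $L:\mathcal E\to\mathcal F$ is a family of bounded operators $L_x:\mathcal E_x\to\mathcal F_x$, $x\in X$, that is norm continuous in local trivialisations. It is a Fredholm morphism if for some $k\in\mathbb Z$ every $L_x$ is a Fredholm operator of index $k$. Let $K(X)$ denote the Grothendieck group of the monoid of isomorphism classes of finite-dimensional $\mathbb K$-vector bundles over $X$ (of locally constant rank) under direct sum; for $\mathbb K=\mathbb R$ this is $KO(X)$. For a Fredholm morphism $L$, a finite-dimensional subbundle $\mathcal V\subset\mathcal F$ is called transversal to the image of $L$ if $\operatorname{im}(L_x)+\mathcal V_x=\mathcal F_x$ for all $x\in X$. Such subbundles $\mathcal V$ exist, for each of them $$E(L,\mathcal V)=\bigcup_{x\in X}\{u\in\mathcal E_x : L_xu\in\mathcal V_x\}$$ is a finite-dimensional subbundle of $\mathcal E$, and the index bundle $$\operatorname{ind}(L)=[E(L,\mathcal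 V)]-[\mathcal V]\in K(X)$$ does not depend on the choice of $\mathcal V$. Let $L:\mathcal E\to\mathcal F$ be a Fredholm morphism and let $K:\mathcal E\to\mathcal F$ be a morphism such that $K_x:\mathcal E_x\to\mathcal F_x$ is a compact operator for every $x\in X$. Then $L+K$ is a Fredholm morphism, the index bundles of $L$ and of $L+K$ are well defined as above, and $$\operatorname{ind}(L+K)=\operatorname{ind}(L)\in K(X).$$ -/

import Mathlib

open Bundle

universe u v

noncomputable section

namespace IndexBundle

/-! ### Finite-dimensional vector bundles and K-theory -/

/-- A family of `𝕜`-vector spaces `E x`, `x : X`, whose total space carries a topology, is a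
finite-dimensional vector bundle if the projection is continuous and every point of `X` has an open
neighbourhood `U` with fibrewise linear isomorphisms `E y ≃ 𝕜ⁿ`, `y ∈ U`, that form a homeomorphism
from the restriction of the total space to `U` onto `U × 𝕜ⁿ`. The rank `n` is locally constant, but
it may differ from one connected component of `X` to another.
(The first argument `Unit` of `TotalSpace` carries no information.) -/
def IsVectorBundle (𝕜 : Type*) [RCLike 𝕜] {X : Type v} [TopologicalSpace X] (E : X → Type u)
    [∀ x, AddCommGroup (E x)] [∀ x, Module 𝕜 (E x)] [TopologicalSpace (TotalSpace Unit E)] :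
    Prop :=
  Continuous (TotalSpace.proj : TotalSpace Unit E → X) ∧
  ∀ x : X, ∃ U : Set X, IsOpen U ∧ x ∈ U ∧ ∃ (n : ℕ) (φ : ∀ y : U, E y ≃ₗ[𝕜] (Fin n → 𝕜)),
    Continuous (fun p : {p : TotalSpace Unit E // p.proj ∈ U} => φ ⟨p.1.proj, p.2⟩ p.1.snd) ∧
    Continuous (fun q : U × (Fin n → 𝕜) => (⟨q.1, (φ q.1).symm q.2⟩ : TotalSpace Unit E))

/-- Finite-dimensional topological `𝕜`-vector bundles over `X`. -/
structure VectBundle (𝕜 : Type*) [RCLike 𝕜] (X : Type v) [TopologicalSpace X] where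
  /-- the fibres -/
  fiber : X → Type u
  [addCommGroup : ∀ x, AddCommGroup (fiber x)]
  [module : ∀ x, Module 𝕜 (fiber x)]
  [top : TopologicalSpace (TotalSpace Unit fiber)]
  isVectorBundle : IsVectorBundle 𝕜 fiber

attribute [instance] VectBundle.addCommGroup VectBundle.module VectBundle.top

namespace VectBundle

variable {𝕜 : Type*} [RCLike 𝕜] {X : Type v} [TopologicalSpace X]

/-- The total space of a vector bundle. -/
abbrev Total (A : VectBundle.{u, v} 𝕜 X) : Type (max u v) := TotalSpace Unit A.fiber

/-- Two vector bundles over `X` are isomorphic if there is a family of linear isomorphisms between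
their fibres which is a homeomorphism of the total spaces. -/
def Iso (A B : VectBundle.{u, v} 𝕜 X) : Prop :=
  ∃ φ : ∀ x, A.fiber x ≃ₗ[𝕜] B.fiber x,
    Continuous (fun p : A.Total => (⟨p.proj, φ p.proj p.snd⟩ : B.Total)) ∧
    Continuous (fun p : B.Total => (⟨p.proj, (φ p.proj).symm p.snd⟩ : A.Total))

theorem Iso.refl (A : VectBundle.{u, v} 𝕜 X) : Iso A A :=
  ⟨fun _ => LinearEquiv.refl _ _, continuous_id, continuous_id⟩

theorem Iso.symm {A B : VectBundle.{u, v} 𝕜 X} : Iso A B → Iso B A := by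
  rintro ⟨φ, h, h'⟩
  exact ⟨fun x => (φ x).symm, h', h⟩

theorem Iso.trans {A B C : VectBundle.{u, v} 𝕜 X} : Iso A B → Iso B C → Iso A C := by
  rintro ⟨φ, h, h'⟩ ⟨ψ, k, k'⟩
  exact ⟨fun x => (φ x).trans (ψ x), k.comp h, h'.comp k'⟩

instance setoid (𝕜 : Type*) [RCLike 𝕜] (X : Type v) [TopologicalSpace X] :
    Setoid (VectBundle.{u, v} 𝕜 X) :=
  ⟨Iso, Iso.refl, Iso.symm, Iso.trans⟩

/-- The zero bundle. -/
def zero (𝕜 : Type*) [RCLike 𝕜] (X : Type v) [TopologicalSpace X] : VectBundle.{u, v} 𝕜 X where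
  fiber _ := PUnit.{u + 1}
  top := TopologicalSpace.induced TotalSpace.proj inferInstance
  isVectorBundle := by
    let _ : TopologicalSpace (TotalSpace Unit fun _ : X => PUnit.{u + 1}) :=
      TopologicalSpace.induced TotalSpace.proj inferInstance
    refine ⟨continuous_induced_dom, fun x => ⟨Set.univ, isOpen_univ, trivial, 0,
      fun _ => LinearEquiv.ofFinrankEq _ _ (by
        simp [Module.finrank_zero_of_subsingleton]), continuous_of_const fun _ _ =>
        Subsingleton.elim _ _, continuous_induced_rng.2 (continuous_subtype_val.comp
          continuous_fst)⟩⟩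

/-- The topology on the total space of `A ⊕ B`, as a subspace of the product of the total
spaces of `A` and `B`. -/
instance sumTop (A B : VectBundle.{u, v} 𝕜 X) :
    TopologicalSpace (TotalSpace Unit fun x => A.fiber x × B.fiber x) :=
  TopologicalSpace.induced
    (fun p => ((⟨p.proj, p.snd.1⟩ : A.Total), (⟨p.proj, p.snd.2⟩ : B.Total))) inferInstance

theorem continuous_sum_fst (A B : VectBundle.{u, v} 𝕜 X) :
    Continuous (fun p : TotalSpace Unit (fun x => A.fiber x × B.fiber x) =>
      (⟨p.proj, p.snd.1⟩ : A.Total)) :=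
  have h : Continuous (fun p : TotalSpace Unit (fun x => A.fiber x × B.fiber x) =>
      ((⟨p.proj, p.snd.1⟩ : A.Total), (⟨p.proj, p.snd.2⟩ : B.Total))) := continuous_induced_dom
  h.fst

theorem continuous_sum_snd (A B : VectBundle.{u, v} 𝕜 X) :
    Continuous (fun p : TotalSpace Unit (fun x => A.fiber x × B.fiber x) =>
      (⟨p.proj, p.snd.2⟩ : B.Total)) :=
  have h : Continuous (fun p : TotalSpace Unit (fun x => A.fiber x × B.fiber x) =>
      ((⟨p.proj, p.snd.1⟩ : A.Total), (⟨p.proj, p.snd.2⟩ : B.Total))) := continuous_induced_dom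
  h.snd

theorem continuous_sum_mk {Z : Type*} [TopologicalSpace Z] (A B : VectBundle.{u, v} 𝕜 X)
    {f : Z → TotalSpace Unit (fun x => A.fiber x × B.fiber x)}
    (h₁ : Continuous fun z => (⟨(f z).proj, (f z).snd.1⟩ : A.Total))
    (h₂ : Continuous fun z => (⟨(f z).proj, (f z).snd.2⟩ : B.Total)) : Continuous f :=
  continuous_induced_rng.2 (h₁.prodMk h₂)

theorem sum_isVectorBundle (A B : VectBundle.{u, v} 𝕜 X) :
    IsVectorBundle 𝕜 fun x => A.fiber x × B.fiber x := by
  refine ⟨A.isVectorBundle.1.comp (continuous_sum_fst A B), fun x => ?_⟩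
  obtain ⟨U, hU, hxU, n, φ, hφ, hφ'⟩ := A.isVectorBundle.2 x
  obtain ⟨V, hV, hxV, m, ψ, hψ, hψ'⟩ := B.isVectorBundle.2 x
  let c : ((Fin n → 𝕜) × (Fin m → 𝕜)) ≃L[𝕜] (Fin (n + m) → 𝕜) :=
    ContinuousLinearEquiv.ofFinrankEq (by simp)
  refine ⟨U ∩ V, hU.inter hV, ⟨hxU, hxV⟩, n + m, fun y =>
    ((φ ⟨y, y.2.1⟩).prodCongr (ψ ⟨y, y.2.2⟩)).trans c.toLinearEquiv, ?_, ?_⟩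
  · refine c.continuous.comp (Continuous.prodMk ?_ ?_)
    · exact hφ.comp (((continuous_sum_fst A B).comp continuous_subtype_val).subtype_mk
        (fun p => p.2.1))
    · exact hψ.comp (((continuous_sum_snd A B).comp continuous_subtype_val).subtype_mk
        (fun p => p.2.2))
  · have hc : Continuous fun q : ↥(U ∩ V) × (Fin (n + m) → 𝕜) => c.symm q.2 :=
      c.symm.continuous.comp continuous_snd
    refine continuous_sum_mk A B ?_ ?_
    · exact hφ'.comp (((continuous_subtype_val.comp continuous_fst).subtype_mk
        (fun q : ↥(U ∩ V) × (Fin (n + m) → 𝕜) => q.1.2.1)).prodMk hc.fst)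
    · exact hψ'.comp (((continuous_subtype_val.comp continuous_fst).subtype_mk
        (fun q : ↥(U ∩ V) × (Fin (n + m) → 𝕜) => q.1.2.2)).prodMk hc.snd)

/-- The Whitney sum of two vector bundles. -/
def sum (A B : VectBundle.{u, v} 𝕜 X) : VectBundle.{u, v} 𝕜 X where
  fiber x := A.fiber x × B.fiber x
  isVectorBundle := sum_isVectorBundle A B

theorem sum_congr {A A' B B' : VectBundle.{u, v} 𝕜 X} :
    Iso A A' → Iso B B' → Iso (A.sum B) (A'.sum B') := by
  rintro ⟨φ, h, h'⟩ ⟨ψ, k, k'⟩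
  exact ⟨fun x => (φ x).prodCongr (ψ x),
    continuous_sum_mk A' B' (h.comp (continuous_sum_fst A B)) (k.comp (continuous_sum_snd A B)),
    continuous_sum_mk A B (h'.comp (continuous_sum_fst A' B'))
      (k'.comp (continuous_sum_snd A' B'))⟩

theorem sum_comm (A B : VectBundle.{u, v} 𝕜 X) : Iso (A.sum B) (B.sum A) :=
  ⟨fun x => LinearEquiv.prodComm 𝕜 (A.fiber x) (B.fiber x),
    continuous_sum_mk B A (continuous_sum_snd A B) (continuous_sum_fst A B),
    continuous_sum_mk A B (continuous_sum_snd B A) (continuous_sum_fst B A)⟩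

theorem sum_assoc (A B C : VectBundle.{u, v} 𝕜 X) :
    Iso ((A.sum B).sum C) (A.sum (B.sum C)) :=
  ⟨fun x => LinearEquiv.prodAssoc 𝕜 (A.fiber x) (B.fiber x) (C.fiber x),
    continuous_sum_mk A (B.sum C)
      ((continuous_sum_fst A B).comp (continuous_sum_fst (A.sum B) C))
      (continuous_sum_mk B C ((continuous_sum_snd A B).comp (continuous_sum_fst (A.sum B) C))
        (continuous_sum_snd (A.sum B) C)),
    continuous_sum_mk (A.sum B) C
      (continuous_sum_mk A B (continuous_sum_fst A (B.sum C))
        ((continuous_sum_fst B C).comp (continuous_sum_snd A (B.sum C))))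
      ((continuous_sum_snd B C).comp (continuous_sum_snd A (B.sum C)))⟩

theorem zero_sum (A : VectBundle.{u, v} 𝕜 X) : Iso ((zero 𝕜 X).sum A) A :=
  ⟨fun _ => LinearEquiv.uniqueProd (M₂ := PUnit.{u + 1}),
    continuous_sum_snd (zero 𝕜 X) A,
    continuous_sum_mk (zero 𝕜 X) A (continuous_induced_rng.2 A.isVectorBundle.1) continuous_id⟩

end VectBundle

/-- The set `Vect(X)` of isomorphism classes of finite-dimensional vector bundles over `X`. -/
def Vect (𝕜 : Type*) [RCLike 𝕜] (X : Type v) [TopologicalSpace X] :=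
  Quotient (VectBundle.setoid.{u, v} 𝕜 X)

instance (𝕜 : Type*) [RCLike 𝕜] (X : Type v) [TopologicalSpace X] : Zero (Vect.{u, v} 𝕜 X) :=
  ⟨Quotient.mk _ (VectBundle.zero 𝕜 X)⟩

instance (𝕜 : Type*) [RCLike 𝕜] (X : Type v) [TopologicalSpace X] : Add (Vect.{u, v} 𝕜 X) :=
  ⟨Quotient.map₂ VectBundle.sum fun _ _ h _ _ k => VectBundle.sum_congr h k⟩

/-- `Vect(X)` is a commutative monoid under the Whitney sum. -/
instance (𝕜 : Type*) [RCLike 𝕜] (X : Type v) [TopologicalSpace X] :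
    AddCommMonoid (Vect.{u, v} 𝕜 X) where
  add_assoc := by
    rintro ⟨A⟩ ⟨B⟩ ⟨C⟩
    exact Quotient.sound (VectBundle.sum_assoc A B C)
  zero_add := by
    rintro ⟨A⟩
    exact Quotient.sound (VectBundle.zero_sum A)
  add_zero := by
    rintro ⟨A⟩
    exact Quotient.sound ((VectBundle.sum_comm A _).trans (VectBundle.zero_sum A))
  add_comm := by
    rintro ⟨A⟩ ⟨B⟩
    exact Quotient.sound (VectBundle.sum_comm A B)
  nsmul := nsmulRec

/-- The K-theory group `K(X)` (which is `KO(X)` for `𝕜 = ℝ`): the Grothendieck group of the monoid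
of isomorphism classes of finite-dimensional `𝕜`-vector bundles over `X`. -/
abbrev KTheory (𝕜 : Type*) [RCLike 𝕜] (X : Type v) [TopologicalSpace X] :=
  Algebra.GrothendieckAddGroup (Vect.{u, v} 𝕜 X)

/-- The class in `K(X)` of a vector bundle. -/
def VectBundle.toKTheory {𝕜 : Type*} [RCLike 𝕜] {X : Type v} [TopologicalSpace X]
    (A : VectBundle.{u, v} 𝕜 X) : KTheory.{u, v} 𝕜 X :=
  Algebra.GrothendieckAddGroup.of (Quotient.mk _ A : Vect.{u, v} 𝕜 X)

/-! ### Finite-dimensional subbundles of Banach bundles -/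

section Subbundle

variable {𝕜 : Type*} [RCLike 𝕜] {X : Type v} [TopologicalSpace X]
  (E : Type*) {𝓔 : X → Type u} [TopologicalSpace (TotalSpace E 𝓔)]
  [∀ x, AddCommGroup (𝓔 x)] [∀ x, Module 𝕜 (𝓔 x)]

/-- The total space of a family of subspaces `V x ⊆ 𝓔 x` has the subspace topology. -/
abbrev subTop (V : ∀ x, Submodule 𝕜 (𝓔 x)) : TopologicalSpace (TotalSpace Unit fun x => V x) :=
  TopologicalSpace.induced (fun p => (⟨p.proj, (p.snd : 𝓔 p.proj)⟩ : TotalSpace E 𝓔)) inferInstance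

/-- A family of subspaces `V x ⊆ 𝓔 x` is a finite-dimensional subbundle of `𝓔` if its total space,
with the topology inherited from that of `𝓔`, is a finite-dimensional vector bundle. -/
def IsFinSubbundle (V : ∀ x, Submodule 𝕜 (𝓔 x)) : Prop :=
  letI := subTop E V
  IsVectorBundle 𝕜 fun x => V x

/-- A finite-dimensional subbundle, as a vector bundle in its own right. -/
def subbundle (V : ∀ x, Submodule 𝕜 (𝓔 x)) (hV : IsFinSubbundle E V) : VectBundle.{u, v} 𝕜 X :=
  letI := subTop E V
  { fiber := fun x => V x
    isVectorBundle := hV }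

end Subbundle

/-! ### Fredholm morphisms and the index bundle -/

/-- The index `dim ker T - dim coker T` of a Fredholm operator. -/
def fredholmIndex {𝕜 M N : Type*} [RCLike 𝕜] [AddCommGroup M] [Module 𝕜 M] [TopologicalSpace M]
    [AddCommGroup N] [Module 𝕜 N] [TopologicalSpace N] (T : M →L[𝕜] N) : ℤ :=
  (Module.finrank 𝕜 T.ker : ℤ) - (Module.finrank 𝕜 (N ⧸ T.range) : ℤ)

section Fredholm

variable {𝕜 : Type*} [RCLike 𝕜] {X : Type v} [TopologicalSpace X]
  (E : Type*) [NormedAddCommGroup E] [NormedSpace 𝕜 E]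
  (F : Type*) [NormedAddCommGroup F] [NormedSpace 𝕜 F]
  {𝓔 : X → Type u} [TopologicalSpace (TotalSpace E 𝓔)] [∀ x, AddCommGroup (𝓔 x)]
  [∀ x, Module 𝕜 (𝓔 x)] [∀ x, TopologicalSpace (𝓔 x)]
  [FiberBundle E 𝓔] [VectorBundle 𝕜 E 𝓔]
  {𝓕 : X → Type u} [TopologicalSpace (TotalSpace F 𝓕)] [∀ x, AddCommGroup (𝓕 x)]
  [∀ x, Module 𝕜 (𝓕 x)] [∀ x, TopologicalSpace (𝓕 x)]
  [∀ x, IsTopologicalAddGroup (𝓕 x)] [∀ x, ContinuousSMul 𝕜 (𝓕 x)]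
  [FiberBundle F 𝓕] [VectorBundle 𝕜 F 𝓕]

/-- A family of bounded operators `L x : 𝓔 x → 𝓕 x` is a morphism of Banach bundles if it is
continuous as a section of the bundle of bounded operators, i.e. if it is given in local
trivialisations by norm continuous maps into the bounded operators `E → F`. -/
def IsMorphism (L : ∀ x, 𝓔 x →L[𝕜] 𝓕 x) : Prop :=
  Continuous fun x => TotalSpace.mk' (E →L[𝕜] F) (E := fun x => 𝓔 x →L[𝕜] 𝓕 x) x (L x)

/-- A Fredholm morphism: a morphism which, for some `k`, is in each fibre a bounded Fredholm
operator of index `k`. -/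
def IsFredholmMorphism (L : ∀ x, 𝓔 x →L[𝕜] 𝓕 x) : Prop :=
  IsMorphism E F L ∧ ∃ k : ℤ, ∀ x, (L x).IsFredholm ∧ fredholmIndex (L x) = k

/-- A finite-dimensional subbundle `V` of `𝓕` is transversal to the image of `L` if
`im (L x) + V x = 𝓕 x` for all `x`. -/
def IsTransversal (L : ∀ x, 𝓔 x →L[𝕜] 𝓕 x) (V : ∀ x, Submodule 𝕜 (𝓕 x)) : Prop :=
  IsFinSubbundle F V ∧ ∀ x, (L x).range ⊔ V x = ⊤

/-- The family `E(L, V)` with fibres `{u ∈ 𝓔 x : L x u ∈ V x}`. -/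
def preimage (L : ∀ x, 𝓔 x →L[𝕜] 𝓕 x) (V : ∀ x, Submodule 𝕜 (𝓕 x)) :
    ∀ x, Submodule 𝕜 (𝓔 x) :=
  fun x => (V x).comap (L x : 𝓔 x →ₗ[𝕜] 𝓕 x)

/-- The element `κ` of `K(X)` is the index bundle of `L`: there is a finite-dimensional subbundle
of `𝓕` that is transversal to the image of `L`, and for every such subbundle `V` the family
`E(L, V)` is a finite-dimensional subbundle of `𝓔` and `κ = [E(L, V)] - [V]`. -/
def IsIndexBundle (L : ∀ x, 𝓔 x →L[𝕜] 𝓕 x) (κ : KTheory.{u, v} 𝕜 X) : Prop :=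
  (∃ V : ∀ x, Submodule 𝕜 (𝓕 x), IsTransversal F L V) ∧
  ∀ (V : ∀ x, Submodule 𝕜 (𝓕 x)) (hV : IsTransversal F L V),
    ∃ hE : IsFinSubbundle E (preimage L V),
      κ = (subbundle E (preimage L V) hE).toKTheory - (subbundle F V hV.1).toKTheory

/-- The index bundle `ind L ∈ K(X)`: the element with the property `IsIndexBundle`. -/
def ind (L : ∀ x, 𝓔 x →L[𝕜] 𝓕 x) : KTheory.{u, v} 𝕜 X :=
  Classical.epsilon fun κ => IsIndexBundle E F L κ

end Fredholm

end IndexBundle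

end

noncomputable section

open Topology Filter LinearMap.FiniteRangeSetoid

namespace IndexBundle

/-! ### Fredholm operators between Banach spaces and their compact perturbations. -/

section Banach

variable {𝕜 E F : Type*} [RCLike 𝕜] [NormedAddCommGroup E] [NormedSpace 𝕜 E]
  [NormedAddCommGroup F] [NormedSpace 𝕜 F]

/-! Join `L` to `L + K` by the pencil `L + tK`, `t ∈ [0, 1]`. By Riesz theory every operator of the
pencil is Fredholm (`isFredholm_add_compact`). Both index bundles can then be computed with a single
subbundle `V`, transversal to the whole pencil, and it remains to see that the bundles `E(L + tK,
V)` are isomorphic for `t = 0` and `t = 1`.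

The subbundle `V` comes from `exists_isTransversal_add_smul`. Transversality is an open condition
and `[0, 1]` and `X` are compact, so finitely many global sections span a transversal subspace in
every fibre for all `t`. Their span need not have constant rank. If the model fibre `F` is
infinite-dimensional, there is room for a small perturbation that makes the sections independent
everywhere (`exists_sections_linearIndependent`); if it is finite-dimensional, `V = 𝓕` works.

The main tool is an inverse of `L` modulo `V`: a morphism `R` with `f - L R f ∈ V` for all `f`. It
exists locally by inverting a bounded operator, and globally by a partition of unity
(`exists_inverse_mod`). Modulo `V`, `L(u + c R K u)` equals `(L + cK)u`, so for small `c` the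
automorphism `1 + c R K` carries `E(L + cK, V)` onto `E(L, V)` (`iso_preimage_add_smul`). Hence the
isomorphism class is locally constant in `t`, and `[0, 1]` is connected
(`iso_preimage_of_homotopy`). Two such inverses, modulo `V` and modulo `V'`, also give `E(L, V) ⊕ V'
≅ E(L, V') ⊕ V`, so the index bundle is well defined (`toKTheory_preimage_sub`). -/

/-- A bounded operator between Banach spaces with finite-dimensional kernel and range of finite
codimension is Fredholm. -/
theorem isFredholm_of_finite [CompleteSpace E] [CompleteSpace F] (T : E →L[𝕜] F)
    (hker : FiniteDimensional 𝕜 T.ker) (hcoker : T.range.CoFG) : T.IsFredholm := by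
  have hk : T.ker.ClosedComplemented := .of_finiteDimensional _
  obtain ⟨C, hC⟩ := hk.exists_isTopCompl
  obtain ⟨D, hD⟩ := T.range.exists_isCompl
  have : FiniteDimensional 𝕜 D := .of_fg (hcoker.fg_of_isCompl hD)
  have hCc : IsClosed (C : Set E) := hC.symm.isClosed
  have : CompleteSpace C := hCc.completeSpace_coe
  have hTC : ∀ u, ∃ c : C, T c = T u := fun u => by
    obtain ⟨k, hk, c, hc, rfl⟩ := Submodule.mem_sup.1
      (hC.isCompl.sup_eq_top ▸ Submodule.mem_top : u ∈ T.ker ⊔ C)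
    exact ⟨⟨c, hc⟩, by rw [map_add, (show T k = 0 from hk), zero_add]⟩
  have hinjC : ∀ c ∈ C, T c = 0 → c = 0 := fun c hc h =>
    Submodule.disjoint_def.1 hC.isCompl.disjoint c h hc
  -- Closedness of the range is not assumed. `Φ` is a bounded bijection of Banach spaces, so the
  -- open mapping theorem inverts it, and the `C`-component of the inverse is a quasi-inverse of
  -- `T`.
  let Φ : (C × D) →L[𝕜] F := (T.comp C.subtypeL).coprod D.subtypeL
  have hΦ : ∀ p, Φ p = T p.1 + p.2 := fun p => by simp [Φ]
  have hinj : Φ.ker = ⊥ := by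
    refine (Submodule.eq_bot_iff _).2 fun p hp => ?_
    have h : T p.1 + p.2 = 0 := by simpa [hΦ] using hp
    have h2 : (p.2 : F) = 0 := Submodule.disjoint_def.1 hD.disjoint _
      ⟨-(p.1 : E), by simpa using neg_eq_of_add_eq_zero_right h⟩ p.2.2
    have h1 : (p.1 : E) = 0 := hinjC _ p.1.2 (by simpa [h2] using h)
    exact Prod.ext (Subtype.ext h1) (Subtype.ext h2)
  have hsurj : Φ.range = ⊤ := by
    refine eq_top_iff.2 fun f _ => ?_
    obtain ⟨_, ⟨u, rfl⟩, d, hd, rfl⟩ := Submodule.mem_sup.1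
      (hD.sup_eq_top ▸ Submodule.mem_top : f ∈ T.range ⊔ D)
    obtain ⟨c, hc⟩ := hTC u
    exact ⟨(c, ⟨d, hd⟩), by simpa [hΦ] using hc⟩
  let e := ContinuousLinearEquiv.ofBijective Φ hinj hsurj
  have he : ∀ c : C, e.symm (T c) = (c, 0) := fun c => by
    rw [ContinuousLinearEquiv.symm_apply_eq]
    simp [e, hΦ]
  let v : F →L[𝕜] E :=
    C.subtypeL.comp ((ContinuousLinearMap.fst 𝕜 C D).comp (e.symm : F →L[𝕜] C × D))
  have hv : ∀ c : C, v (T c) = c := fun c => by simp [v, he]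
  refine ContinuousLinearMap.IsFredholm.of_isQuasiInverse (v := v) ⟨?_, ?_⟩
  · have : C.CoFG := Submodule.FG.cofg_of_isCompl hC.isCompl (.of_finite)
    exact LinearMap.FiniteRangeSetoid.equiv_of_eqOn_coFG this fun c hc => hv ⟨c, hc⟩
  · refine LinearMap.FiniteRangeSetoid.equiv_of_eqOn_coFG hcoker ?_
    rintro _ ⟨u, rfl⟩
    obtain ⟨c, hc⟩ := hTC u
    change T (v (T u)) = T u
    rw [← hc, hv]

theorem exists_linearIndependent_mkQ {M : Type*} [AddCommGroup M] [Module 𝕜 M]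
    (S : Submodule 𝕜 M) (hS : ¬ S.CoFG) (ι : Type*) [Finite ι] :
    ∃ t : ι → M, LinearIndependent 𝕜 (S.mkQ ∘ t) := by
  have h : Cardinal.aleph0 ≤ Module.rank 𝕜 (M ⧸ S) :=
    not_lt.1 fun h => hS (Module.rank_lt_aleph0_iff.1 h)
  obtain ⟨f, hf⟩ := exists_linearIndependent_of_le_rank
    ((Cardinal.natCast_lt_aleph0 (n := Nat.card ι)).le.trans h)
  choose t ht using fun i => S.mkQ_surjective (f i)
  refine ⟨t ∘ Finite.equivFin ι, ?_⟩
  have : S.mkQ ∘ t ∘ Finite.equivFin ι = f ∘ Finite.equivFin ι := funext fun i => ht _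
  rw [this]
  exact hf.comp _ (Finite.equivFin ι).injective

/-- On the kernel `C = -1`, so the identity of the kernel is compact and the kernel is
finite-dimensional. If the cokernel were infinite-dimensional, the kernel could be embedded by some
`φ` into a complement of the range; with `P` a projection onto the kernel, `T + φP` would be
injective and still of the form identity plus compact. The Fredholm alternative makes it surjective,
so the range of `T` has finite codimension after all. -/
theorem isFredholm_one_add_compact [CompleteSpace E] (C : E →L[𝕜] E) (hC : IsCompactOperator C) :
    (1 + C : E →L[𝕜] E).IsFredholm := by
  set T : E →L[𝕜] E := 1 + C with hT
  have hTa : ∀ u, T u = u + C u := fun u => by simp [hT]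
  have hker : FiniteDimensional 𝕜 T.ker := by
    have hN : ∀ u : T.ker, C u = -u := fun u =>
      eq_neg_of_add_eq_zero_right (by rw [← hTa]; exact u.2)
    have h1 : IsCompactOperator (fun u : T.ker => C u) := hC.comp_clm T.ker.subtypeL
    have h2 := (h1.codRestrict (V := T.ker) (fun u => by rw [hN]; exact neg_mem u.2)
      T.isClosed_ker).neg
    refine FiniteDimensional.of_isCompactOperator_id (𝕜 := 𝕜) (E := T.ker) ?_
    have h3 : (id : T.ker → T.ker) =
        -(Set.codRestrict (fun u : T.ker => C u) (T.ker : Set E)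
          (fun u => by rw [hN]; exact neg_mem u.2)) :=
      funext fun u => Subtype.ext (by simp [hN])
    rw [h3]
    exact h2
  refine isFredholm_of_finite _ hker ?_
  by_contra hco
  let b := Module.finBasis 𝕜 T.ker
  obtain ⟨t, ht⟩ := exists_linearIndependent_mkQ _ hco (Fin (Module.finrank 𝕜 T.ker))
  have hk : T.ker.ClosedComplemented := .of_finiteDimensional _
  obtain ⟨P, hP⟩ := hk
  let φ : T.ker →L[𝕜] E := LinearMap.toContinuousLinearMap (b.constr 𝕜 t)
  have hφinj : Function.Injective (T.range.mkQ ∘ₗ (b.constr 𝕜 t)) := by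
    have : T.range.mkQ ∘ₗ (b.constr 𝕜 t) = b.constr 𝕜 (T.range.mkQ ∘ t) := by
      refine b.ext fun i => by simp
    rw [this, injective_iff_map_eq_zero]
    intro x hx
    rw [Module.Basis.constr_apply_fintype] at hx
    exact b.equivFun.map_eq_zero_iff.1 (funext (Fintype.linearIndependent_iff.1 ht _ hx))
  have hcomp : IsCompactOperator (C + φ.comp P) := by
    have : ProperSpace T.ker := FiniteDimensional.proper 𝕜 _
    have h := (isCompactOperator_of_locallyCompactSpace_rng φ).comp_clm P
    exact hC.add h
  have key : ∀ u, u + (C + φ.comp P) u = 0 → u = 0 := fun u hu => by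
    have h1 : T u + φ (P u) = 0 := by
      rw [hTa, add_assoc]; exact hu
    have h2 : T.range.mkQ (b.constr 𝕜 t (P u)) = 0 := by
      have : φ (P u) = T (-u) := by rw [map_neg]; exact eq_neg_of_add_eq_zero_right h1
      exact (Submodule.Quotient.mk_eq_zero _).2 ⟨-u, this.symm⟩
    have h3 : P u = 0 := hφinj (by rw [map_zero]; exact h2)
    have h4 : T u = 0 := by simpa [h3] using h1
    have := hP ⟨u, h4⟩
    rw [h3] at this
    exact (congrArg Subtype.val this).symm
  rcases hcomp.hasEigenvalue_or_mem_resolventSet (μ := (-1 : 𝕜)) (by simp) with h | h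
  · obtain ⟨u, hu⟩ := h.exists_hasEigenvector
    refine hu.2 (key u ?_)
    have := hu.apply_eq_smul
    change (C + φ.comp P) u = _ at this
    rw [this]; simp
  · rw [spectrum.mem_resolventSet_iff, ContinuousLinearMap.isUnit_iff_bijective] at h
    refine hco ?_
    have hs : T.range ⊔ φ.range = ⊤ := by
      refine eq_top_iff.2 fun f _ => ?_
      obtain ⟨u, rfl⟩ := h.2 f
      -- The resolvent is taken at `-1`, so `u` solves `-(T + φP)u = f`; hence the signs.
      refine Submodule.mem_sup.2 ⟨T (-u), ⟨_, rfl⟩, φ (P (-u)), ⟨_, rfl⟩, ?_⟩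
      simp [hTa]
      abel
    have : FiniteDimensional 𝕜 φ.range := inferInstance
    refine Module.Finite.of_surjective (T.range.mkQ ∘ₗ φ.range.subtype) fun q => ?_
    obtain ⟨f, rfl⟩ := T.range.mkQ_surjective q
    obtain ⟨a, ha, b, hb, rfl⟩ := Submodule.mem_sup.1
      (hs ▸ Submodule.mem_top : f ∈ T.range ⊔ φ.range)
    refine ⟨⟨b, hb⟩, ?_⟩
    simpa using ha

/-- For a quasi-inverse `v` of `T`, the operators `v(T + C)` and `(T + C)v` agree with `1 + vC` and
`1 + Cv` up to finite rank, so both are Fredholm. The first bounds the kernel of `T + C`, the second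
its cokernel. -/
theorem isFredholm_add_compact [CompleteSpace E] [CompleteSpace F] (T C : E →L[𝕜] F)
    (hT : T.IsFredholm) (hC : IsCompactOperator C) : (T + C).IsFredholm := by
  obtain ⟨v, hv⟩ := hT.exists_isQuasiInverse
  obtain ⟨a, ha⟩ := (isFredholm_one_add_compact (v.comp C) (hC.clm_comp v)).exists_isQuasiInverse
  obtain ⟨b, hb⟩ := (isFredholm_one_add_compact (C.comp v) (hC.comp_clm v)).exists_isQuasiInverse
  have h1 : (v.comp (T + C)).IsFredholm := by
    refine .of_isQuasiInverse (v := a) (ha.congr (Setoid.refl _) ?_)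
    have h := hv.1
    rw [LinearMap.IsLeftQuasiInverse, equiv_iff_hasFiniteRange] at h
    rw [equiv_iff_hasFiniteRange]
    convert h using 1
    ext u
    simp
  have h2 : ((T + C).comp v).IsFredholm := by
    refine .of_isQuasiInverse (v := b) (hb.congr (Setoid.refl _) ?_)
    have h := hv.2
    rw [LinearMap.IsRightQuasiInverse, equiv_iff_hasFiniteRange] at h
    rw [equiv_iff_hasFiniteRange]
    convert h using 1
    ext u
    simp
  refine isFredholm_of_finite _ ?_ ?_
  · have := h1.finite_ker
    exact Submodule.finiteDimensional_of_le (S₂ := (v.comp (T + C)).ker) fun u hu => by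
      have : (T + C) u = 0 := hu
      change v ((T + C) u) = 0
      rw [this, map_zero]
  · refine h2.finite_coker.of_le ?_
    rintro _ ⟨u, rfl⟩
    exact ⟨v u, rfl⟩

/-! ### Transversality as an open condition. -/

/-- The operator `(u, w) ↦ T u + ∑ wᵢ τᵢ`. -/
def coprodFamily {ι : Type*} [Fintype ι] (T : E →L[𝕜] F) (τ : ι → F) : E × (ι → 𝕜) →L[𝕜] F :=
  T.coprod (∑ i, (ContinuousLinearMap.proj (R := 𝕜) (φ := fun _ : ι => 𝕜) i).smulRight (τ i))

theorem coprodFamily_apply {ι : Type*} [Fintype ι] (T : E →L[𝕜] F) (τ : ι → F)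
    (p : E × (ι → 𝕜)) : coprodFamily T τ p = T p.1 + ∑ i, p.2 i • τ i := by
  simp [coprodFamily]

theorem continuous_coprodFamily {ι : Type*} [Fintype ι] :
    Continuous fun p : (E →L[𝕜] F) × (ι → F) => coprodFamily p.1 p.2 := by
  have h (p : (E →L[𝕜] F) × (ι → F)) : coprodFamily p.1 p.2 =
      p.1.comp (ContinuousLinearMap.fst 𝕜 E (ι → 𝕜)) +
        ∑ i, ((ContinuousLinearMap.proj (R := 𝕜) (φ := fun _ : ι => 𝕜) i).comp
          (ContinuousLinearMap.snd 𝕜 E (ι → 𝕜))).smulRight (p.2 i) := by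
    ext q <;> simp [coprodFamily]
  simp only [h]
  refine (continuous_fst.clm_comp continuous_const).add (continuous_finsetSum _ fun i _ => ?_)
  exact ((ContinuousLinearMap.smulRightL 𝕜 (E × (ι → 𝕜)) F _).continuous).comp
    ((continuous_apply i).comp continuous_snd)

theorem range_coprodFamily {ι : Type*} [Fintype ι] (T : E →L[𝕜] F) (τ : ι → F) :
    (coprodFamily T τ).range = T.range ⊔ Submodule.span 𝕜 (Set.range τ) := by
  ext f
  simp only [Submodule.mem_sup, LinearMap.mem_range]
  constructor
  · rintro ⟨p, rfl⟩
    exact ⟨_, ⟨p.1, rfl⟩, _, (Submodule.mem_span_range_iff_exists_fun 𝕜).2 ⟨p.2, rfl⟩,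
      (coprodFamily_apply T τ p).symm⟩
  · rintro ⟨_, ⟨u, rfl⟩, _, hw, rfl⟩
    obtain ⟨w, rfl⟩ := (Submodule.mem_span_range_iff_exists_fun 𝕜).1 hw
    exact ⟨(u, w), coprodFamily_apply T τ (u, w)⟩

/-- A surjection has a bounded, possibly nonlinear, right inverse `N`. An operator closer to it than
half of `‖N‖⁻¹` still maps onto a neighbourhood of `0`, and a subspace with interior is everything.
-/
theorem isOpen_setOf_range_eq_top [CompleteSpace E] [CompleteSpace F] :
    IsOpen {S : E →L[𝕜] F | S.range = ⊤} := by
  refine isOpen_iff_mem_nhds.2 fun S hS => ?_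
  obtain ⟨N, hN⟩ := S.exists_nonlinearRightInverse_of_surjective hS
  have hN' : 0 < N.nnnorm⁻¹ := by positivity
  filter_upwards [Metric.ball_mem_nhds S (NNReal.coe_pos.2 (half_pos hN'))] with S' hS'
  have happ : ApproximatesLinearOn S' S Set.univ (N.nnnorm⁻¹ / 2) := by
    rintro x - y -
    rw [← map_sub]
    change ‖(S' - S) (x - y)‖ ≤ _
    refine ((S' - S).le_opNorm _).trans (mul_le_mul_of_nonneg_right ?_ (norm_nonneg _))
    exact (dist_eq_norm S' S ▸ (Metric.mem_ball.1 hS').le)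
  have h := happ.image_mem_nhds N (x := 0) univ_mem (Or.inr (half_lt_self hN'))
  rw [Set.image_univ] at h
  exact Submodule.eq_top_of_nonempty_interior' _ ⟨_, mem_interior_iff_mem_nhds.2 h⟩

theorem isOpen_setOf_transversal [CompleteSpace E] [CompleteSpace F] {ι : Type*} [Fintype ι] :
    IsOpen {p : (E →L[𝕜] F) × (ι → F) |
      p.1.range ⊔ Submodule.span 𝕜 (Set.range p.2) = ⊤} := by
  simpa only [Set.preimage_ofPred_eq, range_coprodFamily] using
    isOpen_setOf_range_eq_top.preimage (continuous_coprodFamily (𝕜 := 𝕜) (E := E) (F := F) (ι := ι))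
end Banach

/-! ### Preimages of finite-dimensional subspaces, and inverses modulo a subspace. -/

section Banach

variable {𝕜 E F : Type*} [RCLike 𝕜] [NormedAddCommGroup E] [NormedSpace 𝕜 E]
  [NormedAddCommGroup F] [NormedSpace 𝕜 F]

section Algebra
variable {M N : Type*} [AddCommGroup M] [Module 𝕜 M] [AddCommGroup N] [Module 𝕜 N]

theorem finiteDimensional_comap (T : M →ₗ[𝕜] N) (V : Submodule 𝕜 N) [FiniteDimensional 𝕜 V]
    (hT : FiniteDimensional 𝕜 (LinearMap.ker T)) : FiniteDimensional 𝕜 (V.comap T) := by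
  refine .of_fg (Submodule.fg_of_fg_map_of_fg_inf_ker T ?_ ?_)
  · exact (Submodule.fg_iff_finiteDimensional _).2
      (Submodule.finiteDimensional_of_le (S₂ := V) (Submodule.map_comap_le T V))
  · exact (Submodule.fg_iff_finiteDimensional _).2
      (Submodule.finiteDimensional_of_le (S₂ := LinearMap.ker T) inf_le_right)

/-- Count dimensions in the exact sequence `0 → ker T → T⁻¹(V) → V → N / im T → 0`; here `g` and `q`
are its second and third arrows, and transversality is the surjectivity of `q`. -/
theorem finrank_comap (T : M →ₗ[𝕜] N) (V : Submodule 𝕜 N) [FiniteDimensional 𝕜 V]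
    (hT : FiniteDimensional 𝕜 (LinearMap.ker T)) (hV : LinearMap.range T ⊔ V = ⊤) :
    Module.finrank 𝕜 (V.comap T) + Module.finrank 𝕜 (N ⧸ LinearMap.range T) =
      Module.finrank 𝕜 (LinearMap.ker T) + Module.finrank 𝕜 V := by
  have := finiteDimensional_comap T V hT
  let g : V.comap T →ₗ[𝕜] V := T.restrict fun u hu => hu
  let q : V →ₗ[𝕜] N ⧸ LinearMap.range T := (LinearMap.range T).mkQ ∘ₗ V.subtype
  have hq : LinearMap.range q = ⊤ := by
    refine eq_top_iff.2 fun y _ => ?_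
    obtain ⟨f, rfl⟩ := (LinearMap.range T).mkQ_surjective y
    obtain ⟨a, ha, b, hb, rfl⟩ := Submodule.mem_sup.1 (hV ▸ Submodule.mem_top :
      f ∈ LinearMap.range T ⊔ V)
    exact ⟨⟨b, hb⟩, by simpa [q] using ha⟩
  have hqg : LinearMap.ker q = LinearMap.range g := by
    ext w
    simp only [q, LinearMap.mem_ker, LinearMap.comp_apply, Submodule.mkQ_apply,
      Submodule.Quotient.mk_eq_zero, LinearMap.mem_range, Submodule.subtype_apply]
    constructor
    · rintro ⟨u, hu⟩
      exact ⟨⟨u, by simp [hu]⟩, Subtype.ext hu⟩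
    · rintro ⟨u, rfl⟩
      exact ⟨u, rfl⟩
  have hg : Module.finrank 𝕜 (LinearMap.ker g) = Module.finrank 𝕜 (LinearMap.ker T) := by
    refine LinearEquiv.finrank_eq (LinearEquiv.ofBijective
      (((V.comap T).subtype ∘ₗ (LinearMap.ker g).subtype).codRestrict (LinearMap.ker T)
        fun u => congrArg Subtype.val u.2) ⟨fun a b h => ?_, fun u => ?_⟩)
    · exact Subtype.ext (Subtype.ext (congrArg (fun z : LinearMap.ker T => (z : M)) h))
    · refine ⟨⟨⟨u, ?_⟩, Subtype.ext u.2⟩, rfl⟩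
      have : T u = 0 := u.2
      simp [this]
  have h1 := g.finrank_range_add_finrank_ker
  have h2 := q.finrank_range_add_finrank_ker
  rw [hq, finrank_top, hqg] at h2
  omega

end Algebra

theorem fredholmIndex_eq {M N : Type*} [AddCommGroup M] [Module 𝕜 M] [TopologicalSpace M]
    [AddCommGroup N] [Module 𝕜 N] [TopologicalSpace N] (T : M →L[𝕜] N) (V : Submodule 𝕜 N)
    [FiniteDimensional 𝕜 V] (hT : FiniteDimensional 𝕜 T.ker) (hV : T.range ⊔ V = ⊤) :
    fredholmIndex T =
      (Module.finrank 𝕜 (V.comap (T : M →ₗ[𝕜] N)) : ℤ) - Module.finrank 𝕜 V := by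
  have := finrank_comap (T : M →ₗ[𝕜] N) V hT hV
  unfold fredholmIndex
  omega

/-- At `y₀` the operator `(c, w) ↦ T c + ∑ wᵢ τᵢ` is an isomorphism from `C × 𝕜^ι` onto `F`. It
remains one nearby, with norm continuous inverse, and `R` is the `C`-component of that inverse. The
complement `C` is fixed while `y` varies, which later lets one fixed space parametrise all nearby
fibres of `E(L, V)`. -/
theorem exists_local_inverse_mod [CompleteSpace E] [CompleteSpace F] {Y : Type*}
    [TopologicalSpace Y] {ι : Type*} [Fintype ι] {U : Set Y} (hU : IsOpen U) {y₀ : Y} (hy₀ : y₀ ∈ U)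
    {T : Y → E →L[𝕜] F} (hT : ContinuousOn T U) {τ : Y → ι → F} (hτ : ContinuousOn τ U)
    (hfd : FiniteDimensional 𝕜 (T y₀).ker) (hli : LinearIndependent 𝕜 (τ y₀))
    (htr : (T y₀).range ⊔ Submodule.span 𝕜 (Set.range (τ y₀)) = ⊤) :
    ∃ (C : Submodule 𝕜 E) (R : Y → F →L[𝕜] E) (O : Set Y), IsOpen O ∧ y₀ ∈ O ∧ O ⊆ U ∧
      ContinuousOn R O ∧
      IsCompl ((Submodule.span 𝕜 (Set.range (τ y₀))).comap (T y₀ : E →ₗ[𝕜] F)) C ∧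
      ∀ y ∈ O, (∀ f ∈ Submodule.span 𝕜 (Set.range (τ y)), R y f = 0) ∧
        (∀ f, f - T y (R y f) ∈ Submodule.span 𝕜 (Set.range (τ y))) ∧
        (∀ f, R y f ∈ C) ∧ ∀ c ∈ C, R y (T y c) = c := by
  set N := (Submodule.span 𝕜 (Set.range (τ y₀))).comap (T y₀ : E →ₗ[𝕜] F) with hN
  have : FiniteDimensional 𝕜 (Submodule.span 𝕜 (Set.range (τ y₀))) :=
    FiniteDimensional.span_of_finite 𝕜 (Set.finite_range _)
  have hNfd : FiniteDimensional 𝕜 N := finiteDimensional_comap _ _ hfd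
  obtain ⟨C, hC⟩ := (Submodule.ClosedComplemented.of_finiteDimensional N).exists_isTopCompl
  have hCc : IsClosed (C : Set E) := hC.symm.isClosed
  have : CompleteSpace C := hCc.completeSpace_coe
  let Φ : Y → (C × (ι → 𝕜)) →L[𝕜] F := fun y => coprodFamily ((T y).comp C.subtypeL) (τ y)
  have hΦ : ∀ y p, Φ y p = T y p.1 + ∑ i, p.2 i • τ y i := fun y p => by
    simp [Φ, coprodFamily_apply]
  have hΦc : ContinuousOn Φ U := continuous_coprodFamily.comp_continuousOn
    ((hT.clm_comp continuousOn_const).prodMk hτ)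
  have hsp : ∀ y (w : ι → 𝕜), ∑ i, w i • τ y i ∈ Submodule.span 𝕜 (Set.range (τ y)) :=
    fun y w => (Submodule.mem_span_range_iff_exists_fun 𝕜).2 ⟨w, rfl⟩
  have hinj : (Φ y₀).ker = ⊥ := by
    refine (Submodule.eq_bot_iff _).2 fun p hp => ?_
    have h : T y₀ p.1 + ∑ i, p.2 i • τ y₀ i = 0 := by rw [← hΦ]; exact hp
    have h1 : (p.1 : E) = 0 := by
      refine Submodule.disjoint_def.1 hC.isCompl.disjoint _ ?_ p.1.2
      change T y₀ p.1 ∈ Submodule.span 𝕜 (Set.range (τ y₀))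
      rw [eq_neg_of_add_eq_zero_left h]
      exact neg_mem (hsp _ _)
    rw [h1, map_zero, zero_add] at h
    exact Prod.ext (Subtype.ext h1) (funext (Fintype.linearIndependent_iff.1 hli _ h))
  have hsurj : (Φ y₀).range = ⊤ := by
    refine eq_top_iff.2 fun f _ => ?_
    obtain ⟨_, ⟨u, rfl⟩, d, hd, rfl⟩ := Submodule.mem_sup.1 (htr ▸ Submodule.mem_top :
      f ∈ (T y₀).range ⊔ Submodule.span 𝕜 (Set.range (τ y₀)))
    obtain ⟨n, hn, c, hc, rfl⟩ := Submodule.mem_sup.1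
      (hC.isCompl.sup_eq_top ▸ Submodule.mem_top : u ∈ N ⊔ C)
    obtain ⟨w, hw⟩ := (Submodule.mem_span_range_iff_exists_fun 𝕜).1
      (add_mem (show T y₀ n ∈ Submodule.span 𝕜 (Set.range (τ y₀)) from hn) hd)
    refine ⟨(⟨c, hc⟩, w), ?_⟩
    change Φ y₀ _ = T y₀ (n + c) + d
    rw [hΦ, hw, map_add]
    abel
  let e := ContinuousLinearEquiv.ofBijective (Φ y₀) hinj hsurj
  have he : (e : (C × (ι → 𝕜)) →L[𝕜] F) = Φ y₀ :=
    ContinuousLinearMap.ext fun _ => rfl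
  let Z : Set ((C × (ι → 𝕜)) →L[𝕜] F) :=
    Set.range ((↑) : ((C × (ι → 𝕜)) ≃L[𝕜] F) → ((C × (ι → 𝕜)) →L[𝕜] F))
  have hZ : IsOpen Z := ContinuousLinearEquiv.isOpen
  let R : Y → F →L[𝕜] E :=
    fun y => C.subtypeL.comp ((ContinuousLinearMap.fst 𝕜 C (ι → 𝕜)).comp (Φ y).inverse)
  refine ⟨C, R, U ∩ Φ ⁻¹' Z, hΦc.isOpen_inter_preimage hU hZ, ⟨hy₀, e, he⟩, Set.inter_subset_left,
    ?_, hC.isCompl, ?_⟩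
  · refine continuousOn_const.clm_comp (continuousOn_const.clm_comp ?_)
    rintro y ⟨hyU, e', he'⟩
    have h1 : ContinuousAt ContinuousLinearMap.inverse (Φ y) := by
      rw [← he']
      exact (contDiffAt_map_inverse (n := 0) e').continuousAt
    exact (ContinuousAt.comp h1 (hΦc.continuousAt (hU.mem_nhds hyU))).continuousWithinAt
  · rintro y ⟨hyU, e', he'⟩
    have hinv : (Φ y).inverse = e'.symm := by rw [← he', ContinuousLinearMap.inverse_equiv]
    have hR : ∀ p, e'.symm (T y p.1 + ∑ i, p.2 i • τ y i) = p := fun p => by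
      rw [ContinuousLinearEquiv.symm_apply_eq, ← hΦ, ← he']
      rfl
    have hRa : ∀ f, R y f = ((e'.symm f).1 : E) := fun f => by
      change (((Φ y).inverse f).1 : E) = _
      rw [hinv]
      rfl
    refine ⟨fun f hf => ?_, fun f => ?_, fun f => ?_, fun c hc => ?_⟩
    · obtain ⟨w, rfl⟩ := (Submodule.mem_span_range_iff_exists_fun 𝕜).1 hf
      have := hR (0, w)
      rw [ZeroMemClass.coe_zero, map_zero, zero_add] at this
      rw [hRa, this]
      rfl
    · have : Φ y (e'.symm f) = f := by rw [← he']; exact e'.apply_symm_apply f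
      rw [hΦ] at this
      have h2 : f - T y (R y f) = ∑ i, (e'.symm f).2 i • τ y i := by
        rw [hRa, sub_eq_iff_eq_add, add_comm]; exact this.symm
      exact h2 ▸ hsp _ _
    · rw [hRa]
      exact Subtype.mem _
    · have := hR (⟨c, hc⟩, 0)
      simp only [Pi.zero_apply, zero_smul, Finset.sum_const_zero, add_zero] at this
      rw [hRa, this]

/-- A partition of unity approximates `f` on `B` by combinations of finitely many of its values,
hence by a map into a finite-dimensional `F₀`. Adding a small constant family that is independent
modulo `F₀` gives independence at every point at once. -/
theorem exists_approx_linearIndependent (hF : ¬ FiniteDimensional 𝕜 F) {X : Type*}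
    [TopologicalSpace X] [CompactSpace X] [T2Space X] {ι : Type*} [Fintype ι] {U B : Set X}
    (hU : IsOpen U) (hB : IsClosed B) (hBU : B ⊆ U) {f : X → ι → F} (hf : ContinuousOn f U)
    {δ : ℝ} (hδ : 0 < δ) :
    ∃ g : X → ι → F, Continuous g ∧ (∀ x ∈ B, ‖g x - f x‖ < δ) ∧
      ∀ x, LinearIndependent 𝕜 (g x) := by
  let _ : NormedSpace ℝ F := NormedSpace.restrictScalars ℝ 𝕜 F
  obtain ⟨J, -, hJf, hJ⟩ := ((hB.isCompact.image_of_continuousOn (hf.mono hBU))).finite_cover_balls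
    (half_pos hδ)
  have : Fintype J := hJf.fintype
  -- The condition on the coefficients is convex and holds locally with a constant choice, so
  -- continuous coefficients exist; off `B` it is void.
  obtain ⟨c, hc⟩ : ∃ c : C(X, J → ℝ), ∀ x, c x ∈ {c : J → ℝ | x ∈ B →
      ∑ j, c j • (j : ι → F) ∈ Metric.ball (f x) (δ / 2)} := by
    refine exists_continuous_forall_mem_convex_of_local_const (fun x => ?_) fun x => ?_
    · by_cases hx : x ∈ B
      · simp only [hx, true_imp_iff]
        refine (convex_ball (f x) (δ / 2)).is_linear_preimage
          (f := fun c : J → ℝ => ∑ j, c j • (j : ι → F)) ⟨fun a b => ?_, fun r a => ?_⟩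
        · simp [add_smul, Finset.sum_add_distrib]
        · simp [mul_smul, Finset.smul_sum]
      · simp [hx, convex_univ]
    · by_cases hx : x ∈ B
      · obtain ⟨j, hj, hxj⟩ := Set.mem_iUnion₂.1 (hJ ⟨x, hx, rfl⟩)
        classical
        refine ⟨Pi.single ⟨j, hj⟩ 1, ?_⟩
        have h := (hf.continuousAt (hU.mem_nhds (hBU hx))).preimage_mem_nhds
          (Metric.isOpen_ball.mem_nhds hxj)
        filter_upwards [h] with y hy _
        have : ∑ i : J, (Pi.single (M := fun _ => ℝ) ⟨j, hj⟩ 1 : J → ℝ) i • (i : ι → F) = j := by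
          rw [Finset.sum_eq_single ⟨j, hj⟩] <;> simp +contextual
        rw [this]
        exact Metric.mem_ball_comm.1 hy
      · exact ⟨0, by filter_upwards [hB.isOpen_compl.mem_nhds hx] with y hy h using absurd h hy⟩
  let F₀ := Submodule.span 𝕜 (Set.range fun p : J × ι => (p.1 : ι → F) p.2)
  have hF₀ : FiniteDimensional 𝕜 F₀ := FiniteDimensional.span_of_finite 𝕜 (Set.finite_range _)
  obtain ⟨t, ht⟩ := exists_linearIndependent_mkQ F₀
    (fun h => hF (Module.Finite.of_submodule_quotient F₀)) ι
  -- One half of `δ` was spent on the approximation; the other half pays for the shift by `ε • t`.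
  obtain ⟨ε, hε, hεt⟩ : ∃ ε : ℝ, 0 < ε ∧ ‖ε • t‖ < δ / 2 := by
    refine ⟨δ / 2 / (‖t‖ + 1), by positivity, ?_⟩
    rw [norm_smul, Real.norm_of_nonneg (by positivity), div_mul_eq_mul_div,
      div_lt_iff₀ (by positivity)]
    nlinarith [norm_nonneg t]
  refine ⟨fun x => ∑ j, c x j • (j : ι → F) + ε • t, by fun_prop, fun x hx => ?_, fun x => ?_⟩
  · have h := hc x hx
    rw [Metric.mem_ball, dist_eq_norm] at h
    rw [add_sub_right_comm]
    linarith [norm_add_le (∑ j, c x j • (j : ι → F) - f x) (ε • t)]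
  · refine LinearIndependent.of_comp F₀.mkQ ?_
    have hu : ((ε : ℝ) : 𝕜) ≠ 0 := by simpa using hε.ne'
    convert ht.units_smul (fun _ => Units.mk0 _ hu) using 1
    ext i
    have h0 : (∑ j, c x j • (j : ι → F)) i ∈ F₀ := by
      rw [Finset.sum_apply]
      refine sum_mem fun j _ => ?_
      rw [Pi.smul_apply, RCLike.real_smul_eq_coe_smul (K := 𝕜)]
      exact F₀.smul_mem _ (Submodule.subset_span ⟨(j, i), rfl⟩)
    have h1 : F₀.mkQ ((∑ j, c x j • (j : ι → F)) i) = 0 := (Submodule.Quotient.mk_eq_zero _).2 h0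
    change F₀.mkQ ((∑ j, c x j • (j : ι → F)) i + ε • t i) = (ε : 𝕜) • F₀.mkQ (t i)
    rw [map_add, h1, zero_add, RCLike.real_smul_eq_coe_smul (K := 𝕜), map_smul]
end Banach

theorem exists_leftInverse_of_linearIndependent {𝕜 F : Type*} [RCLike 𝕜] [NormedAddCommGroup F]
    [NormedSpace 𝕜 F] {ι : Type*} [Fintype ι] {τ : ι → F} (hτ : LinearIndependent 𝕜 τ) :
    ∃ G : F →L[𝕜] (ι → 𝕜), ∀ w : ι → 𝕜, G (∑ i, w i • τ i) = w := by
  have : FiniteDimensional 𝕜 (Submodule.span 𝕜 (Set.range τ)) :=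
    FiniteDimensional.span_of_finite 𝕜 (Set.finite_range _)
  obtain ⟨P, hP⟩ := Submodule.ClosedComplemented.of_finiteDimensional
    (Submodule.span 𝕜 (Set.range τ))
  let b := Module.Basis.span hτ
  refine ⟨(LinearMap.toContinuousLinearMap b.equivFun.toLinearMap).comp P, fun w => ?_⟩
  have h : ∑ i, w i • τ i = ((b.equivFun.symm w : Submodule.span 𝕜 (Set.range τ)) : F) := by
    rw [Module.Basis.equivFun_symm_apply]
    simp [b, Module.Basis.span_apply]
  change b.equivFun (P _) = w
  rw [h, hP, LinearEquiv.apply_symm_apply]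

/-! ### Subbundles and their local frames. -/

section Frames

variable {𝕜 : Type*} [RCLike 𝕜] {X : Type v} [TopologicalSpace X]
  {F : Type*} {𝓕 : X → Type u} [TopologicalSpace (TotalSpace F 𝓕)] [∀ x, AddCommGroup (𝓕 x)]
  [∀ x, Module 𝕜 (𝓕 x)]

variable (F) in
/-- Sections of `𝓕` which form a continuous frame of the family of subspaces `V` over `U`. -/
structure IsFrameOn (V : ∀ x, Submodule 𝕜 (𝓕 x)) (U : Set X) {ι : Type*} (s : ι → ∀ x, 𝓕 x) :
    Prop where
  continuousAt : ∀ i, ∀ x ∈ U, ContinuousAt (fun y => TotalSpace.mk' F y (s i y)) x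
  linearIndependent : ∀ x ∈ U, LinearIndependent 𝕜 fun i => s i x
  span_eq : ∀ x ∈ U, Submodule.span 𝕜 (Set.range fun i => s i x) = V x

theorem exists_isFrameOn {V : ∀ x, Submodule 𝕜 (𝓕 x)} (hV : IsFinSubbundle F V) (x₀ : X) :
    ∃ U : Set X, IsOpen U ∧ x₀ ∈ U ∧ ∃ (n : ℕ) (s : Fin n → ∀ x, 𝓕 x), IsFrameOn F V U s := by
  obtain ⟨U, hU, hx₀, n, φ, -, hφ⟩ := hV.2 x₀
  classical
  -- The value `0` off `U` is a dummy: frames are only tested at points of the open set `U`.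
  let s : Fin n → ∀ x, 𝓕 x := fun i x =>
    if h : x ∈ U then ((φ ⟨x, h⟩).symm (Pi.single i 1) : V x) else 0
  have hs : ∀ i (x : U), s i x = ((Module.Basis.ofEquivFun (φ x)) i : 𝓕 x) := fun i x => by
    simp [s]
  refine ⟨U, hU, hx₀, n, s, ⟨fun i x hx => ?_, fun x hx => ?_, fun x hx => ?_⟩⟩
  · suffices h : ContinuousOn (fun y => TotalSpace.mk' F y (s i y)) U from
      h.continuousAt (hU.mem_nhds hx)
    rw [continuousOn_iff_continuous_domRestrict]
    let _ : TopologicalSpace (TotalSpace Unit fun x => V x) := subTop F V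
    have h := (@continuous_induced_dom _ _ (fun p : TotalSpace Unit fun x => V x =>
      (⟨p.proj, (p.snd : 𝓕 p.proj)⟩ : TotalSpace F 𝓕)) _).comp (hφ.comp
        (Continuous.prodMk_left (Pi.single i (1 : 𝕜))))
    convert h using 1
    ext1 y
    simp [s]
  · have := (Module.Basis.ofEquivFun (φ ⟨x, hx⟩)).linearIndependent.map'
      (V x).subtype (V x).ker_subtype
    have h1 : (fun i => s i x) = (V x).subtype ∘ (Module.Basis.ofEquivFun (φ ⟨x, hx⟩)) :=
      funext fun i => hs i ⟨x, hx⟩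
    rwa [h1]
  · have h1 : (fun i => s i x) = (V x).subtype ∘ (Module.Basis.ofEquivFun (φ ⟨x, hx⟩)) :=
      funext fun i => hs i ⟨x, hx⟩
    rw [h1, Set.range_comp, Submodule.span_image, Module.Basis.span_eq, Submodule.map_top,
      Submodule.range_subtype]

end Frames

/-! ### Continuity in one Banach bundle. -/

section OneBundle

variable {𝕜 : Type*} [RCLike 𝕜] {X : Type v} [TopologicalSpace X]
  {F : Type*} [NormedAddCommGroup F] [NormedSpace 𝕜 F]
  {𝓕 : X → Type u} [TopologicalSpace (TotalSpace F 𝓕)] [∀ x, AddCommGroup (𝓕 x)]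
  [∀ x, Module 𝕜 (𝓕 x)] [∀ x, TopologicalSpace (𝓕 x)]
  [FiberBundle F 𝓕]

variable (𝕜) in
-- The base point depends on an arbitrary parameter `z`, so that the same criterion serves sections
-- over `X` and fibrewise maps defined on total spaces.
theorem continuousAt_mk_iff [VectorBundle 𝕜 F 𝓕] (e : Trivialization F (π F 𝓕))
    [MemTrivializationAtlas e] {Z : Type*} [TopologicalSpace Z] {b : Z → X} {s : ∀ z, 𝓕 (b z)} {z₀ : Z}
    (h : b z₀ ∈ e.baseSet) :
    ContinuousAt (fun z => TotalSpace.mk' F (b z) (s z)) z₀ ↔ ContinuousAt b z₀ ∧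
      ContinuousAt (fun z => e.continuousLinearMapAt 𝕜 (b z) (s z)) z₀ := by
  rw [ContinuousAt, e.tendsto_nhds_iff (e.mem_source.2 h)]
  refine and_congr_right fun hb => ?_
  have hb' : ContinuousAt b z₀ := hb
  have : (fun z => e.continuousLinearMapAt 𝕜 (b z) (s z)) =ᶠ[𝓝 z₀]
      fun z => (e (TotalSpace.mk' F (b z) (s z))).2 := by
    filter_upwards [hb'.preimage_mem_nhds (e.open_baseSet.mem_nhds h)] with z hz
    exact e.continuousLinearMapAt_apply_of_mem 𝕜 hz _
  rw [continuousAt_congr this]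
  rfl

variable (𝕜) in
theorem continuousAt_mk_add [VectorBundle 𝕜 F 𝓕] {Z : Type*} [TopologicalSpace Z] {b : Z → X}
    {s t : ∀ z, 𝓕 (b z)}
    {z₀ : Z} (hs : ContinuousAt (fun z => TotalSpace.mk' F (b z) (s z)) z₀)
    (ht : ContinuousAt (fun z => TotalSpace.mk' F (b z) (t z)) z₀) :
    ContinuousAt (fun z => TotalSpace.mk' F (b z) (s z + t z)) z₀ := by
  have hb := FiberBundle.mem_baseSet_trivializationAt' (F := F) (E := 𝓕) (b z₀)
  rw [continuousAt_mk_iff 𝕜 (trivializationAt F 𝓕 (b z₀)) hb] at hs ht ⊢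
  refine ⟨hs.1, ?_⟩
  simp only [map_add]
  exact hs.2.add ht.2

theorem continuousAt_mk_smul [VectorBundle 𝕜 F 𝓕] {Z : Type*} [TopologicalSpace Z] {b : Z → X}
    {s : ∀ z, 𝓕 (b z)}
    {c : Z → 𝕜} {z₀ : Z} (hc : ContinuousAt c z₀)
    (hs : ContinuousAt (fun z => TotalSpace.mk' F (b z) (s z)) z₀) :
    ContinuousAt (fun z => TotalSpace.mk' F (b z) (c z • s z)) z₀ := by
  have hb := FiberBundle.mem_baseSet_trivializationAt' (F := F) (E := 𝓕) (b z₀)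
  rw [continuousAt_mk_iff 𝕜 (trivializationAt F 𝓕 (b z₀)) hb] at hs ⊢
  refine ⟨hs.1, ?_⟩
  simp only [map_smul]
  exact hc.smul hs.2

variable (𝕜) in
theorem continuousAt_mk_sub [VectorBundle 𝕜 F 𝓕] {Z : Type*} [TopologicalSpace Z] {b : Z → X}
    {s t : ∀ z, 𝓕 (b z)}
    {z₀ : Z} (hs : ContinuousAt (fun z => TotalSpace.mk' F (b z) (s z)) z₀)
    (ht : ContinuousAt (fun z => TotalSpace.mk' F (b z) (t z)) z₀) :
    ContinuousAt (fun z => TotalSpace.mk' F (b z) (s z - t z)) z₀ := by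
  have := continuousAt_mk_add 𝕜 hs (continuousAt_mk_smul (continuousAt_const (y := (-1 : 𝕜))) ht)
  simpa [sub_eq_add_neg] using this

variable (𝕜) in
theorem continuousAt_mk_zero [VectorBundle 𝕜 F 𝓕] {Z : Type*} [TopologicalSpace Z]
    {b : Z → X} {z₀ : Z} (hb : ContinuousAt b z₀) :
    ContinuousAt (fun z => TotalSpace.mk' F (b z) (0 : 𝓕 (b z))) z₀ := by
  rw [continuousAt_mk_iff 𝕜 (trivializationAt F 𝓕 (b z₀))
    (FiberBundle.mem_baseSet_trivializationAt' (b z₀))]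
  refine ⟨hb, ?_⟩
  simp only [map_zero]
  exact continuousAt_const

variable (𝕜) in
theorem continuousAt_mk_sum [VectorBundle 𝕜 F 𝓕] {Z : Type*} [TopologicalSpace Z]
    {b : Z → X} {ι : Type*} (J : Finset ι) {s : ι → ∀ z, 𝓕 (b z)} {z₀ : Z} (hb : ContinuousAt b z₀)
    (hs : ∀ i ∈ J, ContinuousAt (fun z => TotalSpace.mk' F (b z) (s i z)) z₀) :
    ContinuousAt (fun z => TotalSpace.mk' F (b z) (∑ i ∈ J, s i z)) z₀ := by
  classical
  induction J using Finset.induction_on with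
  | empty => simpa using continuousAt_mk_zero 𝕜 hb
  | insert i J hi ih =>
    simp only [Finset.sum_insert hi]
    exact continuousAt_mk_add 𝕜 (hs i (Finset.mem_insert_self i J))
      (ih fun j hj => hs j (Finset.mem_insert_of_mem hj))

/-- Only the continuity of the coefficients needs an argument. Let `G` recover coefficients from the
frame at one point. Composing `G` with the frame at nearby points gives matrices `A x` that are the
identity at that point, hence invertible close to it, and the coefficients of a vector are `A⁻¹`
applied to its image under `G`. -/
theorem isFinSubbundle_of_frames [VectorBundle 𝕜 F 𝓕] {V : ∀ x, Submodule 𝕜 (𝓕 x)}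
    (h : ∀ x₀ : X, ∃ U : Set X, IsOpen U ∧ x₀ ∈ U ∧ ∃ (n : ℕ) (s : Fin n → ∀ x, 𝓕 x),
      IsFrameOn F V U s) : IsFinSubbundle F V := by
  let ρ : (TotalSpace Unit fun x => V x) → TotalSpace F 𝓕 := fun p => ⟨p.proj, p.snd⟩
  let _ : TopologicalSpace (TotalSpace Unit fun x => V x) := subTop F V
  have hρ : Continuous ρ := continuous_induced_dom
  have hproj : Continuous fun p : (TotalSpace Unit fun x => V x) => p.proj :=
    (FiberBundle.continuous_proj F 𝓕).comp hρ
  refine ⟨hproj, fun x₀ => ?_⟩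
  obtain ⟨U, hU, hx₀, n, s, hs⟩ := h x₀
  let b : ∀ y : U, Module.Basis (Fin n) 𝕜 (V y) := fun y =>
    (Module.Basis.span (hs.linearIndependent y y.2)).map (LinearEquiv.ofEq _ _ (hs.span_eq y y.2))
  have hb : ∀ (y : U) i, (b y i : 𝓕 y) = s i y := fun y i => by
    simp [b, Module.Basis.span_apply]
  have hbsum : ∀ (y : U) (w : Fin n → 𝕜), (((b y).equivFun.symm w : V y) : 𝓕 y) =
      ∑ i, w i • s i y := fun y w => by simp [Module.Basis.equivFun_symm_apply, hb]
  refine ⟨U, hU, hx₀, n, fun y => (b y).equivFun, ?_, ?_⟩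
  · rw [continuous_iff_continuousAt]
    intro p₀
    let e := trivializationAt F 𝓕 p₀.1.proj
    have hbase : p₀.1.proj ∈ e.baseSet := FiberBundle.mem_baseSet_trivializationAt' _
    let τ : X → Fin n → F := fun x i => e.continuousLinearMapAt 𝕜 x (s i x)
    have hτ : ContinuousAt τ p₀.1.proj := continuousAt_pi.2 fun i =>
      ((continuousAt_mk_iff 𝕜 e (b := fun x => x) hbase).1 (hs.continuousAt i _ p₀.2)).2
    have hτli : LinearIndependent 𝕜 (τ p₀.1.proj) := by
      have := (hs.linearIndependent _ p₀.2).map'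
        (e.continuousLinearEquivAt 𝕜 _ hbase).toLinearEquiv.toLinearMap (LinearEquiv.ker _)
      have h1 : τ p₀.1.proj = (e.continuousLinearEquivAt 𝕜 _ hbase) ∘ fun i => s i p₀.1.proj :=
        funext fun i => e.continuousLinearMapAt_apply_of_mem 𝕜 hbase _
      rwa [h1]
    obtain ⟨G, hG⟩ := exists_leftInverse_of_linearIndependent hτli
    let A : X → (Fin n → 𝕜) →L[𝕜] (Fin n → 𝕜) := fun x =>
      G.comp (∑ i, (ContinuousLinearMap.proj (R := 𝕜) (φ := fun _ : Fin n => 𝕜) i).smulRight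
        (τ x i))
    have hA : ∀ x w, A x w = G (∑ i, w i • τ x i) := fun x w => by
      simp [A]
    have hA₀ : A p₀.1.proj = 1 := ContinuousLinearMap.ext fun w => by simp [hA, hG]
    have hAc : ContinuousAt A p₀.1.proj := by
      rw [continuousAt_clm_apply]
      intro w
      simp only [hA]
      exact G.continuous.continuousAt.comp (tendsto_finsetSum _ fun i _ =>
        ((continuousAt_pi.1 hτ i).const_smul (w i)))
    have hAu : ∀ᶠ x in 𝓝 p₀.1.proj, IsUnit (A x) :=
      hAc.eventually (by rw [hA₀]; exact Units.isOpen.mem_nhds isUnit_one)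
    have hpc : ContinuousAt (fun p : {p : TotalSpace Unit fun x => V x // p.proj ∈ U} =>
        p.1.proj) p₀ := (hproj.comp continuous_subtype_val).continuousAt
    have hev : (fun p : {p : TotalSpace Unit fun x => V x // p.proj ∈ U} =>
        (b ⟨p.1.proj, p.2⟩).equivFun p.1.snd) =ᶠ[𝓝 p₀] fun p =>
          Ring.inverse (A p.1.proj)
            (G (e.continuousLinearMapAt 𝕜 p.1.proj (p.1.snd : 𝓕 p.1.proj))) := by
      filter_upwards [hpc.eventually hAu] with p hp
      set w := (b ⟨p.1.proj, p.2⟩).equivFun p.1.snd with hw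
      have h1 : (p.1.snd : 𝓕 p.1.proj) = ∑ i, w i • s i p.1.proj := by
        rw [← hbsum ⟨p.1.proj, p.2⟩ w, hw, LinearEquiv.symm_apply_apply]
      have h2 : G (e.continuousLinearMapAt 𝕜 p.1.proj (p.1.snd : 𝓕 p.1.proj)) =
          A p.1.proj w := by
        rw [hA, h1, map_sum]
        simp [τ]
      rw [h2, ← mul_apply_eq_comp, Ring.inverse_mul_cancel _ hp,
        one_apply_eq_self]
    refine (continuousAt_congr hev).2 ?_
    have hinv : ContinuousAt Ring.inverse (A p₀.1.proj) := by
      rw [hA₀]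
      exact NormedRing.inverse_continuousAt 1
    have hAp : ContinuousAt (fun p : {p : TotalSpace Unit fun x => V x // p.proj ∈ U} =>
        A p.1.proj) p₀ := ContinuousAt.comp (f := fun p : {p : TotalSpace Unit fun x => V x //
          p.proj ∈ U} => p.1.proj) hAc hpc
    refine ContinuousAt.clm_apply (ContinuousAt.comp (f := fun p : {p : TotalSpace Unit
      fun x => V x // p.proj ∈ U} => A p.1.proj) hinv hAp)
      (G.continuous.continuousAt.comp ?_)
    exact ((continuousAt_mk_iff 𝕜 e (b := fun p : {p : TotalSpace Unit fun x => V x //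
      p.proj ∈ U} => p.1.proj) (s := fun p => (p.1.snd : 𝓕 p.1.proj)) hbase).1
        (hρ.comp continuous_subtype_val).continuousAt).2
  · refine continuous_induced_rng.2 (continuous_iff_continuousAt.2 fun q => ?_)
    simp only [Function.comp_def, hbsum]
    have hc : Continuous fun q : U × (Fin n → 𝕜) => (q.1 : X) :=
      continuous_subtype_val.comp continuous_fst
    exact continuousAt_mk_sum 𝕜 _ hc.continuousAt fun i _ => continuousAt_mk_smul
      ((continuous_apply i).comp continuous_snd).continuousAt
        (ContinuousAt.comp (f := fun q : U × (Fin n → 𝕜) => (q.1 : X))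
          (hs.continuousAt i _ q.1.2) hc.continuousAt)

end OneBundle

/-! ### Morphisms in trivialisations, and inverses of a morphism modulo `V`. -/

section TwoBundles

variable {𝕜 : Type*} [RCLike 𝕜] {X : Type v} [TopologicalSpace X]
  {E : Type*} [NormedAddCommGroup E] [NormedSpace 𝕜 E]
  {F : Type*} [NormedAddCommGroup F] [NormedSpace 𝕜 F]
  {𝓔 : X → Type u} [TopologicalSpace (TotalSpace E 𝓔)] [∀ x, AddCommGroup (𝓔 x)]
  [∀ x, Module 𝕜 (𝓔 x)] [∀ x, TopologicalSpace (𝓔 x)]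
  [FiberBundle E 𝓔] [VectorBundle 𝕜 E 𝓔]
  {𝓕 : X → Type u} [TopologicalSpace (TotalSpace F 𝓕)] [∀ x, AddCommGroup (𝓕 x)]
  [∀ x, Module 𝕜 (𝓕 x)] [∀ x, TopologicalSpace (𝓕 x)]
  [FiberBundle F 𝓕] [VectorBundle 𝕜 F 𝓕]

/-- The expression of an operator between fibres in trivialisations. -/
def inTriv (e : Trivialization E (π E 𝓔)) [MemTrivializationAtlas e]
    (e' : Trivialization F (π F 𝓕)) [MemTrivializationAtlas e'] {x : X} (T : 𝓔 x →L[𝕜] 𝓕 x) :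
    E →L[𝕜] F :=
  (e'.continuousLinearMapAt 𝕜 x).comp (T.comp (e.symmL 𝕜 x))

theorem inTriv_apply_continuousLinearMapAt (e : Trivialization E (π E 𝓔))
    [MemTrivializationAtlas e] (e' : Trivialization F (π F 𝓕)) [MemTrivializationAtlas e'] {x : X}
    (h : x ∈ e.baseSet) (T : 𝓔 x →L[𝕜] 𝓕 x) (u : 𝓔 x) :
    inTriv e e' T (e.continuousLinearMapAt 𝕜 x u) = e'.continuousLinearMapAt 𝕜 x (T u) := by
  simp only [inTriv, ContinuousLinearMap.comp_apply, e.symmL_continuousLinearMapAt h]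

theorem symmL_inTriv (e : Trivialization E (π E 𝓔))
    [MemTrivializationAtlas e] (e' : Trivialization F (π F 𝓕)) [MemTrivializationAtlas e'] {x : X}
    (h : x ∈ e'.baseSet) (T : 𝓔 x →L[𝕜] 𝓕 x) (u : E) :
    e'.symmL 𝕜 x (inTriv e e' T u) = T (e.symmL 𝕜 x u) := by
  simp only [inTriv, ContinuousLinearMap.comp_apply, e'.symmL_continuousLinearMapAt h]

theorem continuousLinearMapAt_injective (e : Trivialization E (π E 𝓔)) [MemTrivializationAtlas e]
    {x : X} (h : x ∈ e.baseSet) : Function.Injective (e.continuousLinearMapAt 𝕜 x) :=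
  fun u v huv => by
    rw [← e.symmL_continuousLinearMapAt (R := 𝕜) h u, huv, e.symmL_continuousLinearMapAt h]

theorem symmL_injective (e : Trivialization E (π E 𝓔)) [MemTrivializationAtlas e]
    {x : X} (h : x ∈ e.baseSet) : Function.Injective (e.symmL 𝕜 x) :=
  fun u v huv => by
    rw [← e.continuousLinearMapAt_symmL (R := 𝕜) h u, huv, e.continuousLinearMapAt_symmL h]

theorem continuousAt_symmL_const (e : Trivialization E (π E 𝓔)) [MemTrivializationAtlas e]
    {x : X} (h : x ∈ e.baseSet) {f : X → E} (hf : ContinuousAt f x) :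
    ContinuousAt (fun y => TotalSpace.mk' E y (e.symmL 𝕜 y (f y))) x := by
  rw [continuousAt_mk_iff 𝕜 e (b := fun y => y) h]
  refine ⟨continuousAt_id, hf.congr ?_⟩
  filter_upwards [e.open_baseSet.mem_nhds h] with y hy
  rw [e.continuousLinearMapAt_symmL hy]

variable [∀ x, IsTopologicalAddGroup (𝓕 x)] [∀ x, ContinuousSMul 𝕜 (𝓕 x)]

variable (E F) in
/-- A family of bounded operators is norm continuous at `x`. -/
def IsMorphismAt (L : ∀ x, 𝓔 x →L[𝕜] 𝓕 x) (x : X) : Prop :=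
  ContinuousAt (fun x => TotalSpace.mk' (E →L[𝕜] F) (E := fun x => 𝓔 x →L[𝕜] 𝓕 x) x (L x)) x

theorem isMorphism_iff {L : ∀ x, 𝓔 x →L[𝕜] 𝓕 x} :
    IsMorphism E F L ↔ ∀ x, IsMorphismAt E F L x :=
  continuous_iff_continuousAt

theorem isMorphismAt_iff (e : Trivialization E (π E 𝓔)) [MemTrivializationAtlas e]
    (e' : Trivialization F (π F 𝓕)) [MemTrivializationAtlas e'] {L : ∀ x, 𝓔 x →L[𝕜] 𝓕 x}
    {x₀ : X} (h : x₀ ∈ e.baseSet) (h' : x₀ ∈ e'.baseSet) :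
    IsMorphismAt E F L x₀ ↔ ContinuousAt (fun x => inTriv e e' (L x)) x₀ := by
  unfold IsMorphismAt
  rw [ContinuousAt, (e.continuousLinearMap (RingHom.id 𝕜) e').tendsto_nhds_iff
    ((e.continuousLinearMap (RingHom.id 𝕜) e').mem_source.2 ⟨h, h'⟩)]
  exact ⟨fun h => h.2, fun h => ⟨tendsto_id, h⟩⟩

theorem IsMorphismAt.apply {L : ∀ x, 𝓔 x →L[𝕜] 𝓕 x} {Z : Type*} [TopologicalSpace Z] {b : Z → X}
    {s : ∀ z, 𝓔 (b z)} {z₀ : Z} (hL : IsMorphismAt E F L (b z₀))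
    (hs : ContinuousAt (fun z => TotalSpace.mk' E (b z) (s z)) z₀) :
    ContinuousAt (fun z => TotalSpace.mk' F (b z) (L (b z) (s z))) z₀ := by
  have hb : ContinuousAt b z₀ := (FiberBundle.continuous_proj E 𝓔).continuousAt.comp hs
  exact ContinuousAt.clm_bundle_apply (ϕ := fun z => L (b z))
    (ContinuousAt.comp (f := b) hL hb) hs

variable [∀ x, IsTopologicalAddGroup (𝓔 x)] [∀ x, ContinuousSMul 𝕜 (𝓔 x)]

/-- In trivialisations `exists_local_inverse_mod` provides the inverse `S` of `L` modulo `V`. The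
operator `1 - S L` maps the fixed space `N`, the preimage at `x₀`, isomorphically onto each nearby
fibre of `E(L, V)`, so a basis of `N` becomes a frame. -/
theorem exists_local_data [CompleteSpace E] [CompleteSpace F] {L : ∀ x, 𝓔 x →L[𝕜] 𝓕 x}
    (hL : IsMorphism E F L) (hfd : ∀ x, FiniteDimensional 𝕜 (L x).ker)
    {V : ∀ x, Submodule 𝕜 (𝓕 x)} (hV : IsTransversal F L V) (x₀ : X) :
    ∃ O : Set X, IsOpen O ∧ x₀ ∈ O ∧
      (∃ R : ∀ x, 𝓕 x →L[𝕜] 𝓔 x, ∀ x ∈ O, IsMorphismAt F E R x ∧ ∀ f, f - L x (R x f) ∈ V x) ∧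
      ∃ (n : ℕ) (s : Fin n → ∀ x, 𝓔 x), IsFrameOn E (preimage L V) O s := by
  obtain ⟨U, hU, hx₀, m, s, hs⟩ := exists_isFrameOn hV.1 x₀
  let e := trivializationAt E 𝓔 x₀
  let e' := trivializationAt F 𝓕 x₀
  have he : x₀ ∈ e.baseSet := FiberBundle.mem_baseSet_trivializationAt' _
  have he' : x₀ ∈ e'.baseSet := FiberBundle.mem_baseSet_trivializationAt' _
  let W : Set X := U ∩ (e.baseSet ∩ e'.baseSet)
  have hW : IsOpen W := hU.inter (e.open_baseSet.inter e'.open_baseSet)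
  let T : X → E →L[𝕜] F := fun x => inTriv e e' (L x)
  let τ : X → Fin m → F := fun x i => e'.continuousLinearMapAt 𝕜 x (s i x)
  have hT : ContinuousOn T W := fun x hx =>
    ((isMorphismAt_iff e e' hx.2.1 hx.2.2).1 (isMorphism_iff.1 hL x)).continuousWithinAt
  have hτ : ContinuousOn τ W := fun x hx => ContinuousAt.continuousWithinAt <|
    continuousAt_pi.2 fun i => ((continuousAt_mk_iff 𝕜 e' (b := fun x => x) hx.2.2).1
      (hs.continuousAt i _ hx.1)).2
  have hτs : ∀ x ∈ W, Submodule.span 𝕜 (Set.range (τ x)) =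
      (V x).map (e'.continuousLinearMapAt 𝕜 x : 𝓕 x →ₗ[𝕜] F) := fun x hx => by
    rw [← hs.span_eq x hx.1, ← Submodule.span_image, ← Set.range_comp]
    rfl
  have hmem : ∀ x ∈ W, ∀ f : 𝓕 x, e'.continuousLinearMapAt 𝕜 x f ∈
      Submodule.span 𝕜 (Set.range (τ x)) ↔ f ∈ V x := fun x hx f => by
    rw [hτs x hx]
    exact Function.Injective.mem_set_image (continuousLinearMapAt_injective e' hx.2.2)
  have hli : LinearIndependent 𝕜 (τ x₀) :=
    (hs.linearIndependent x₀ hx₀).map' (e'.continuousLinearMapAt 𝕜 x₀ : 𝓕 x₀ →ₗ[𝕜] F)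
      (LinearMap.ker_eq_bot.2 (continuousLinearMapAt_injective e' he'))
  have hker : FiniteDimensional 𝕜 (T x₀).ker := by
    have := hfd x₀
    refine Module.Finite.of_injective ((((e.symmL 𝕜 x₀ : E →ₗ[𝕜] 𝓔 x₀)).comp
      (T x₀).ker.subtype).codRestrict (L x₀).ker fun u => ?_) fun u w huw => ?_
    · have h1 : T x₀ u = 0 := u.2
      change L x₀ (e.symmL 𝕜 x₀ u) = 0
      rw [← symmL_inTriv e e' he']
      exact (congrArg _ h1).trans (map_zero _)
    · exact Subtype.ext (symmL_injective e he (congrArg Subtype.val huw))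
  have htr : (T x₀).range ⊔ Submodule.span 𝕜 (Set.range (τ x₀)) = ⊤ := by
    refine eq_top_iff.2 fun f _ => ?_
    obtain ⟨_, ⟨u, rfl⟩, w, hw, h⟩ := Submodule.mem_sup.1
      (hV.2 x₀ ▸ Submodule.mem_top : e'.symmL 𝕜 x₀ f ∈ (L x₀).range ⊔ V x₀)
    refine Submodule.mem_sup.2 ⟨_, ⟨e.continuousLinearMapAt 𝕜 x₀ u, rfl⟩,
      e'.continuousLinearMapAt 𝕜 x₀ w, (hmem x₀ ⟨hx₀, he, he'⟩ w).2 hw, ?_⟩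
    rw [← e'.continuousLinearMapAt_symmL (R := 𝕜) he' f, ← h, map_add]
    congr 1
    exact inTriv_apply_continuousLinearMapAt e e' he _ _
  obtain ⟨C, R, O, hO, hxO, hOW, hRc, hC, hR⟩ :=
    exists_local_inverse_mod hW ⟨hx₀, he, he'⟩ hT hτ hker hli htr
  let S : ∀ x, 𝓕 x →L[𝕜] 𝓔 x := fun x =>
    (e.symmL 𝕜 x).comp ((R x).comp (e'.continuousLinearMapAt 𝕜 x))
  have hSc : ∀ x ∈ O, IsMorphismAt F E S x := fun x hx => by
    rw [isMorphismAt_iff e' e (hOW hx).2.2 (hOW hx).2.1]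
    refine (hRc.continuousAt (hO.mem_nhds hx)).congr ?_
    filter_upwards [hO.mem_nhds hx] with y hy
    ext f
    simp [inTriv, S, (hOW hy).2.1, (hOW hy).2.2]
  have hSL : ∀ x ∈ O, ∀ u, S x (L x (e.symmL 𝕜 x u)) = e.symmL 𝕜 x (R x (T x u)) :=
    fun x hx u => rfl
  have hS0 : ∀ x ∈ O, ∀ v ∈ V x, S x v = 0 := fun x hx v hv => by
    change e.symmL 𝕜 x (R x (e'.continuousLinearMapAt 𝕜 x v)) = 0
    rw [(hR x hx).1 _ ((hmem x (hOW hx) v).2 hv), map_zero]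
  have hSV : ∀ x ∈ O, ∀ f, f - L x (S x f) ∈ V x := fun x hx f => by
    rw [← hmem x (hOW hx), map_sub]
    exact (hR x hx).2.1 _
  refine ⟨O, hO, hxO, ⟨S, fun x hx => ⟨hSc x hx, hSV x hx⟩⟩, ?_⟩
  set N := (Submodule.span 𝕜 (Set.range (τ x₀))).comap (T x₀ : E →ₗ[𝕜] F)
  have : FiniteDimensional 𝕜 (Submodule.span 𝕜 (Set.range (τ x₀))) :=
    FiniteDimensional.span_of_finite 𝕜 (Set.finite_range _)
  have hNfd : FiniteDimensional 𝕜 N := finiteDimensional_comap _ _ hker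
  let β := Module.finBasis 𝕜 N
  let P : ∀ x, E →ₗ[𝕜] 𝓔 x := fun x =>
    (e.symmL 𝕜 x : E →ₗ[𝕜] 𝓔 x) - ((S x).comp ((L x).comp (e.symmL 𝕜 x)) : E →ₗ[𝕜] 𝓔 x)
  have hP : ∀ x u, P x u = e.symmL 𝕜 x u - S x (L x (e.symmL 𝕜 x u)) := fun x u => rfl
  refine ⟨_, fun i x => P x (β i), ⟨fun i x hx => ?_, fun x hx => ?_, fun x hx => ?_⟩⟩
  · have h1 := continuousAt_symmL_const (𝕜 := 𝕜) e (hOW hx).2.1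
      (continuousAt_const (y := (β i : E)))
    simp only [hP]
    exact continuousAt_mk_sub 𝕜 h1 ((hSc x hx).apply (b := fun x => x)
      ((isMorphism_iff.1 hL x).apply (b := fun x => x) h1))
  · have h1 : LinearIndependent 𝕜 ((P x ∘ₗ N.subtype) ∘ β) := by
      -- If `1 - S L` kills `n ∈ N`, then `n` lies in the image of `R`, hence in `C`, and `N ∩ C =
      -- 0`.
      refine β.linearIndependent.map' _ (LinearMap.ker_eq_bot'.2 fun n hn => ?_)
      have h2 : e.symmL 𝕜 x n - S x (L x (e.symmL 𝕜 x n)) = 0 := hn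
      rw [hSL x hx, ← map_sub] at h2
      have h3 := symmL_injective e (hOW hx).2.1 (h2.trans (map_zero _).symm)
      have h4 : (n : E) ∈ C := by rw [sub_eq_zero.1 h3]; exact (hR x hx).2.2.1 _
      exact Subtype.ext (Submodule.disjoint_def.1 hC.disjoint _ n.2 h4)
    exact h1
  · have h1 : (fun i => P x (β i)) = (P x ∘ₗ N.subtype) ∘ β := rfl
    rw [h1, Set.range_comp, Submodule.span_image, β.span_eq, Submodule.map_top]
    refine le_antisymm ?_ fun u hu => ?_
    · rintro _ ⟨n, rfl⟩
      change L x (P x n) ∈ V x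
      rw [hP, map_sub]
      exact hSV x hx _
    -- For `u = n + c` in the fibre, `S L u = 0` and `S L c = c`, so `S L n = -c` and `(1 - S L) n =
    -- u`.
    · obtain ⟨n, hn, c, hc, hnc⟩ := Submodule.mem_sup.1 (hC.sup_eq_top ▸ Submodule.mem_top :
        e.continuousLinearMapAt 𝕜 x u ∈ N ⊔ C)
      have hu' : e.symmL 𝕜 x n + e.symmL 𝕜 x c = u := by
        rw [← map_add, hnc, e.symmL_continuousLinearMapAt (hOW hx).2.1]
      have hu0 : S x (L x u) = 0 := hS0 x hx _ hu
      have hc0 : S x (L x (e.symmL 𝕜 x c)) = e.symmL 𝕜 x c := by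
        rw [hSL x hx, (hR x hx).2.2.2 c hc]
      refine ⟨⟨n, hn⟩, ?_⟩
      change P x n = u
      rw [← hu', map_add, map_add, hc0] at hu0
      rw [hP, eq_neg_of_add_eq_zero_left hu0, sub_neg_eq_add, hu']

theorem isFinSubbundle_preimage [CompleteSpace E] [CompleteSpace F] {L : ∀ x, 𝓔 x →L[𝕜] 𝓕 x}
    (hL : IsMorphism E F L) (hfd : ∀ x, FiniteDimensional 𝕜 (L x).ker)
    {V : ∀ x, Submodule 𝕜 (𝓕 x)} (hV : IsTransversal F L V) :
    IsFinSubbundle E (preimage L V) :=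
  isFinSubbundle_of_frames fun x₀ => by
    obtain ⟨O, hO, hx, -, h⟩ := exists_local_data hL hfd hV x₀
    exact ⟨O, hO, hx, h⟩

/-- Being an inverse modulo `V` is an affine condition on `R`, so local solutions glue by a
partition of unity. -/
theorem exists_inverse_mod [CompactSpace X] [T2Space X] [CompleteSpace E] [CompleteSpace F]
    {L : ∀ x, 𝓔 x →L[𝕜] 𝓕 x} (hL : IsMorphism E F L)
    (hfd : ∀ x, FiniteDimensional 𝕜 (L x).ker)
    {V : ∀ x, Submodule 𝕜 (𝓕 x)} (hV : IsTransversal F L V) :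
    ∃ R : ∀ x, 𝓕 x →L[𝕜] 𝓔 x, IsMorphism F E R ∧ ∀ x f, f - L x (R x f) ∈ V x := by
  choose O hO hxO hR _ using exists_local_data hL hfd hV
  choose R hR using hR
  obtain ⟨J, hJ⟩ := isCompact_univ.elim_finite_subcover O hO
    fun x _ => Set.mem_iUnion.2 ⟨x, hxO x⟩
  obtain ⟨ρ, hρ⟩ := PartitionOfUnity.exists_isSubordinate isClosed_univ (fun j : J => O j)
    (fun j => hO j) fun x hx => by
      obtain ⟨j, hj, h⟩ := Set.mem_iUnion₂.1 (hJ hx)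
      exact Set.mem_iUnion.2 ⟨⟨j, hj⟩, h⟩
  have hsum : ∀ x, ∑ j, ((ρ j x : ℝ) : 𝕜) = 1 := fun x => by
    rw [← RCLike.ofReal_sum, ← finsum_eq_sum_of_fintype, ρ.sum_eq_one (Set.mem_univ x),
      RCLike.ofReal_one]
  have hout : ∀ (j : J) x, x ∉ O j → ρ j x = 0 := fun j x hx =>
    image_eq_zero_of_notMem_tsupport fun h => hx (hρ j h)
  refine ⟨fun x => ∑ j : J, ((ρ j x : ℝ) : 𝕜) • R j x, ?_, fun x f => ?_⟩
  · refine isMorphism_iff.2 fun x => ?_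
    refine continuousAt_mk_sum 𝕜 (F := F →L[𝕜] E) (𝓕 := fun x => 𝓕 x →L[𝕜] 𝓔 x)
      (b := fun x => x) Finset.univ continuousAt_id fun j _ => ?_
    by_cases hx : x ∈ O j
    · exact continuousAt_mk_smul (RCLike.continuous_ofReal.comp (ρ j).continuous).continuousAt
        (hR j x hx).1
    · refine (continuousAt_mk_zero 𝕜 (F := F →L[𝕜] E) (𝓕 := fun x => 𝓕 x →L[𝕜] 𝓔 x)
        (b := fun x => x) continuousAt_id).congr ?_
      have : x ∉ tsupport (ρ j) := fun h => hx (hρ j h)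
      filter_upwards [(isClosed_tsupport _).isOpen_compl.mem_nhds this] with y hy
      rw [image_eq_zero_of_notMem_tsupport hy, RCLike.ofReal_zero, zero_smul]
  · have : f - L x ((∑ j : J, ((ρ j x : ℝ) : 𝕜) • R j x) f) =
        ∑ j : J, ((ρ j x : ℝ) : 𝕜) • (f - L x (R j x f)) := by
      simp only [smul_sub, Finset.sum_sub_distrib, ← Finset.sum_smul, hsum, one_smul]
      simp [map_sum]
    rw [this]
    refine sum_mem fun j _ => ?_
    by_cases hx : x ∈ O j
    · exact (V x).smul_mem _ ((hR j x hx).2 f)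
    · rw [hout j x hx, RCLike.ofReal_zero, zero_smul]
      exact zero_mem _

end TwoBundles

/-! ### Isomorphisms of vector bundles, classes in K-theory, and transport to the model fibres. -/

/-- Continuity of the inverse is automatic: in local frames the map is a continuous family of
invertible matrices, and inversion is continuous. -/
theorem VectBundle.iso_of_continuous {𝕜 : Type*} [RCLike 𝕜] {X : Type v} [TopologicalSpace X]
    {A B : VectBundle.{u, v} 𝕜 X} (f : ∀ x, A.fiber x ≃ₗ[𝕜] B.fiber x)
    (hf : Continuous fun p : A.Total => (⟨p.proj, f p.proj p.snd⟩ : B.Total)) : A.Iso B := by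
  refine ⟨f, hf, continuous_iff_continuousAt.2 fun p₀ => ?_⟩
  obtain ⟨U, hU, hxU, n, φ, hφ, hφ'⟩ := A.isVectorBundle.2 p₀.proj
  obtain ⟨V, hV, hxV, m, ψ, hψ, -⟩ := B.isVectorBundle.2 p₀.proj
  let W := U ∩ V
  let M : W → ((Fin n → 𝕜) ≃L[𝕜] (Fin m → 𝕜)) := fun y =>
    (((φ ⟨y, y.2.1⟩).symm.trans (f y)).trans (ψ ⟨y, y.2.2⟩)).toContinuousLinearEquiv
  have hM : Continuous fun y : W => (M y : (Fin n → 𝕜) →L[𝕜] (Fin m → 𝕜)) := by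
    refine continuous_clm_apply.2 fun w => ?_
    have h1 : Continuous fun y : W => (⟨y, f y ((φ ⟨y, y.2.1⟩).symm w)⟩ : B.Total) :=
      hf.comp (hφ'.comp (((continuous_subtype_val.subtype_mk fun y : W => y.2.1)).prodMk
        continuous_const))
    exact hψ.comp (h1.subtype_mk fun y => y.2.2)
  have hM' : Continuous fun y : W => ((M y).symm : (Fin m → 𝕜) →L[𝕜] (Fin n → 𝕜)) := by
    refine continuous_iff_continuousAt.2 fun y => ?_
    have h := ContinuousAt.comp (f := fun y : W => (M y : (Fin n → 𝕜) →L[𝕜] (Fin m → 𝕜)))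
      (contDiffAt_map_inverse (𝕜 := 𝕜) (n := 0) (M y)).continuousAt hM.continuousAt
    simpa [Function.comp_def] using h
  have hO : IsOpen {p : B.Total | p.proj ∈ W} := (hU.inter hV).preimage B.isVectorBundle.1
  suffices h : ContinuousOn (fun p : B.Total => (⟨p.proj, (f p.proj).symm p.snd⟩ : A.Total))
      {p : B.Total | p.proj ∈ W} from h.continuousAt (hO.mem_nhds ⟨hxU, hxV⟩)
  rw [continuousOn_iff_continuous_domRestrict]
  have hw : Continuous fun p : {p : B.Total | p.proj ∈ W} => (⟨p.1.proj, p.2⟩ : W) :=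
    (B.isVectorBundle.1.comp continuous_subtype_val).subtype_mk fun p => p.2
  have h1 : Continuous fun p : {p : B.Total | p.proj ∈ W} =>
      (M ⟨p.1.proj, p.2⟩).symm (ψ ⟨p.1.proj, p.2.2⟩ p.1.snd) :=
    (hM'.comp hw).clm_apply (hψ.comp (continuous_subtype_val.subtype_mk
      fun p : {p : B.Total | p.proj ∈ W} => p.2.2))
  have h2 := hφ'.comp (((continuous_subtype_val.comp hw).subtype_mk
    (fun p : {p : B.Total | p.proj ∈ W} => p.2.1)).prodMk h1)
  convert h2 using 1
  ext1 p
  change _ = (⟨p.1.proj, (φ ⟨p.1.proj, p.2.1⟩).symm (φ ⟨p.1.proj, p.2.1⟩ ((f p.1.proj).symm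
    ((ψ ⟨p.1.proj, p.2.2⟩).symm (ψ ⟨p.1.proj, p.2.2⟩ p.1.snd))))⟩ : A.Total)
  simp

theorem VectBundle.toKTheory_sum {𝕜 : Type*} [RCLike 𝕜] {X : Type v} [TopologicalSpace X]
    (A B : VectBundle.{u, v} 𝕜 X) : (A.sum B).toKTheory = A.toKTheory + B.toKTheory :=
  map_add (M := Vect.{u, v} 𝕜 X) Algebra.GrothendieckAddGroup.of
    (Quotient.mk (VectBundle.setoid 𝕜 X) A) (Quotient.mk (VectBundle.setoid 𝕜 X) B)

theorem VectBundle.Iso.toKTheory_eq {𝕜 : Type*} [RCLike 𝕜] {X : Type v} [TopologicalSpace X]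
    {A B : VectBundle.{u, v} 𝕜 X} (h : A.Iso B) : A.toKTheory = B.toKTheory :=
  congrArg Algebra.GrothendieckAddGroup.of (Quotient.sound h)

theorem isFredholm_congr {𝕜 M N M' N' : Type*} [RCLike 𝕜]
    [AddCommGroup M] [Module 𝕜 M] [TopologicalSpace M]
    [AddCommGroup N] [Module 𝕜 N] [TopologicalSpace N]
    [AddCommGroup M'] [Module 𝕜 M'] [TopologicalSpace M']
    [AddCommGroup N'] [Module 𝕜 N'] [TopologicalSpace N']
    [IsTopologicalAddGroup M] [ContinuousSMul 𝕜 M] [T2Space M]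
    [IsTopologicalAddGroup N] [ContinuousSMul 𝕜 N] [T2Space N]
    [IsTopologicalAddGroup M'] [ContinuousSMul 𝕜 M'] [T2Space M']
    [IsTopologicalAddGroup N'] [ContinuousSMul 𝕜 N'] [T2Space N']
    {T : M →L[𝕜] N} (hT : T.IsFredholm) (a : M ≃L[𝕜] M') (b : N ≃L[𝕜] N') :
    ((b : N →L[𝕜] N').comp (T.comp (a.symm : M' →L[𝕜] M))).IsFredholm := by
  obtain ⟨v, hv⟩ := hT.exists_isQuasiInverse
  refine .of_isQuasiInverse (v := (a : M →L[𝕜] M').comp (v.comp (b.symm : N' →L[𝕜] N))) ?_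
  have hb := b.toLinearEquiv.isQuasiInverse
  have ha := a.symm.toLinearEquiv.isQuasiInverse
  exact ha.comp (hv.comp hb)

/-- The fibres carry a topology but no norm, so the perturbation theorem is applied to the model
fibres and carried back. -/
theorem isFredholm_add_of_isCompactOperator {𝕜 E F M N : Type*} [RCLike 𝕜]
    [NormedAddCommGroup E] [NormedSpace 𝕜 E] [CompleteSpace E]
    [NormedAddCommGroup F] [NormedSpace 𝕜 F] [CompleteSpace F]
    [AddCommGroup M] [Module 𝕜 M] [TopologicalSpace M]
    [AddCommGroup N] [Module 𝕜 N] [TopologicalSpace N]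
    [IsTopologicalAddGroup M] [ContinuousSMul 𝕜 M] [T2Space M]
    [IsTopologicalAddGroup N] [ContinuousSMul 𝕜 N] [T2Space N]
    (a : M ≃L[𝕜] E) (b : N ≃L[𝕜] F) {T C : M →L[𝕜] N} (hT : T.IsFredholm)
    (hC : IsCompactOperator C) : (T + C).IsFredholm := by
  have h1 := isFredholm_add_compact _ ((b : N →L[𝕜] F).comp (C.comp (a.symm : E →L[𝕜] M)))
    (isFredholm_congr hT a b) ((hC.comp_clm (a.symm : E →L[𝕜] M)).clm_comp (b : N →L[𝕜] F))
  have h2 := isFredholm_congr h1 a.symm b.symm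
  convert h2 using 1
  ext u
  simp

section Fibres

variable {𝕜 : Type*} [RCLike 𝕜] {X : Type v} [TopologicalSpace X]
  {E : Type*} [NormedAddCommGroup E] [NormedSpace 𝕜 E]
  {𝓔 : X → Type u} [TopologicalSpace (TotalSpace E 𝓔)] [∀ x, AddCommGroup (𝓔 x)]
  [∀ x, Module 𝕜 (𝓔 x)] [∀ x, TopologicalSpace (𝓔 x)]
  [FiberBundle E 𝓔] [VectorBundle 𝕜 E 𝓔]

variable (𝕜 E 𝓔) in
/-- The fibres of a Banach bundle are isomorphic to the model fibre. -/
def fibreEquiv (x : X) : 𝓔 x ≃L[𝕜] E :=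
  (trivializationAt E 𝓔 x).continuousLinearEquivAt 𝕜 x
    (FiberBundle.mem_baseSet_trivializationAt' x)

end Fibres

/-- The main theorem has this property as an instance for `𝓕` only; for `𝓔` it is inherited from the
model fibre. -/
theorem isTopologicalAddGroup_fibre (𝕜 : Type*) [RCLike 𝕜] {X : Type v} [TopologicalSpace X]
    (E : Type*) [NormedAddCommGroup E] [NormedSpace 𝕜 E]
    (𝓔 : X → Type u) [TopologicalSpace (TotalSpace E 𝓔)] [∀ x, AddCommGroup (𝓔 x)]
    [∀ x, Module 𝕜 (𝓔 x)] [∀ x, TopologicalSpace (𝓔 x)]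
    [FiberBundle E 𝓔] [VectorBundle 𝕜 E 𝓔]
    (x : X) : IsTopologicalAddGroup (𝓔 x) :=
  (fibreEquiv 𝕜 E 𝓔 x).toHomeomorph.isInducing.topologicalAddGroup (fibreEquiv 𝕜 E 𝓔 x)

theorem continuousSMul_fibre (𝕜 : Type*) [RCLike 𝕜] {X : Type v} [TopologicalSpace X]
    (E : Type*) [NormedAddCommGroup E] [NormedSpace 𝕜 E]
    (𝓔 : X → Type u) [TopologicalSpace (TotalSpace E 𝓔)] [∀ x, AddCommGroup (𝓔 x)]
    [∀ x, Module 𝕜 (𝓔 x)] [∀ x, TopologicalSpace (𝓔 x)]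
    [FiberBundle E 𝓔] [VectorBundle 𝕜 E 𝓔]
    (x : X) : ContinuousSMul 𝕜 (𝓔 x) :=
  (fibreEquiv 𝕜 E 𝓔 x).toHomeomorph.isInducing.continuousSMul continuous_id
    (map_smul (fibreEquiv 𝕜 E 𝓔 x) _ _)

theorem t2Space_fibre (𝕜 : Type*) [RCLike 𝕜] {X : Type v} [TopologicalSpace X]
    (E : Type*) [NormedAddCommGroup E] [NormedSpace 𝕜 E]
    (𝓔 : X → Type u) [TopologicalSpace (TotalSpace E 𝓔)] [∀ x, AddCommGroup (𝓔 x)]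
    [∀ x, Module 𝕜 (𝓔 x)] [∀ x, TopologicalSpace (𝓔 x)]
    [FiberBundle E 𝓔] [VectorBundle 𝕜 E 𝓔]
    (x : X) : T2Space (𝓔 x) :=
  (fibreEquiv 𝕜 E 𝓔 x).toHomeomorph.isEmbedding.t2Space

section Subbundles

variable {𝕜 : Type*} [RCLike 𝕜] {X : Type v} [TopologicalSpace X]
  {E : Type*} {𝓔 : X → Type u} [TopologicalSpace (TotalSpace E 𝓔)] [∀ x, AddCommGroup (𝓔 x)]
  [∀ x, Module 𝕜 (𝓔 x)]

theorem continuous_subbundle_coe {V : ∀ x, Submodule 𝕜 (𝓔 x)} (hV : IsFinSubbundle E V) :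
    Continuous fun p : (subbundle E V hV).Total => TotalSpace.mk' E p.proj (p.snd : V p.proj).1 :=
  continuous_induced_dom

theorem continuous_subbundle_mk {V : ∀ x, Submodule 𝕜 (𝓔 x)} (hV : IsFinSubbundle E V)
    {Z : Type*} [TopologicalSpace Z] {b : Z → X} {s : ∀ z, V (b z)}
    (h : Continuous fun z => TotalSpace.mk' E (b z) (s z).1) :
    Continuous fun z => (⟨b z, s z⟩ : (subbundle E V hV).Total) :=
  continuous_induced_rng.2 h

end Subbundles

/-! ### Independence of `V`, and small perturbations of the morphism. -/

section Swap

variable {𝕜 : Type*} [RCLike 𝕜] {X : Type v} [TopologicalSpace X]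
  {E : Type*} [NormedAddCommGroup E] [NormedSpace 𝕜 E]
  {F : Type*} [NormedAddCommGroup F] [NormedSpace 𝕜 F]
  {𝓔 : X → Type u} [TopologicalSpace (TotalSpace E 𝓔)] [∀ x, AddCommGroup (𝓔 x)]
  [∀ x, Module 𝕜 (𝓔 x)] [∀ x, TopologicalSpace (𝓔 x)]
  [FiberBundle E 𝓔] [VectorBundle 𝕜 E 𝓔]
  {𝓕 : X → Type u} [TopologicalSpace (TotalSpace F 𝓕)] [∀ x, AddCommGroup (𝓕 x)]
  [∀ x, Module 𝕜 (𝓕 x)] [∀ x, TopologicalSpace (𝓕 x)]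
  [FiberBundle F 𝓕] [VectorBundle 𝕜 F 𝓕]

/-- For subspaces `V`, `V'` and inverses `R`, `R'` of `L` modulo `V` and modulo `V'`, the
isomorphism `L⁻¹(V) × V' ≃ L⁻¹(V') × V`. -/
def preimageProdEquiv {M N : Type*} [AddCommGroup M] [Module 𝕜 M] [AddCommGroup N] [Module 𝕜 N]
    (L : M →ₗ[𝕜] N) (V V' : Submodule 𝕜 N) (R R' : N →ₗ[𝕜] M) (hR : ∀ f, f - L (R f) ∈ V)
    (hR' : ∀ f, f - L (R' f) ∈ V') : (V.comap L × V') ≃ₗ[𝕜] (V'.comap L × V) where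
  -- Both products parametrise the triples `(w, v, v')` in `M × V × V'` with `L w = v + v'`: the
  -- left one by `w = u + R v'`, the right one by `w = u' + R' v`. The map passes from one
  -- coordinate system to the other.
  toFun p := ⟨⟨p.1 + R p.2 - R' (L (p.1 + R p.2) - p.2), by
      have h := V'.add_mem p.2.2 (hR' (L (p.1 + R p.2) - p.2))
      simp only [Submodule.mem_comap, map_sub, map_add] at h ⊢
      convert h using 1
      abel⟩,
    ⟨L (p.1 + R p.2) - p.2, by
      have h := V.sub_mem p.1.2 (hR p.2)
      simp only [map_add]
      convert h using 1
      abel⟩⟩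
  map_add' p q := by
    ext <;> simp only [Prod.fst_add, Prod.snd_add, Submodule.coe_add, map_add, map_sub] <;> abel
  map_smul' c p := by
    ext <;> simp only [Prod.smul_fst, Prod.smul_snd, Submodule.coe_smul, map_add, map_sub,
      map_smul, RingHom.id_apply, smul_add, smul_sub]
  invFun p := ⟨⟨p.1 + R' p.2 - R (L (p.1 + R' p.2) - p.2), by
      have h := V.add_mem p.2.2 (hR (L (p.1 + R' p.2) - p.2))
      simp only [Submodule.mem_comap, map_sub, map_add] at h ⊢
      convert h using 1
      abel⟩,
    ⟨L (p.1 + R' p.2) - p.2, by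
      have h := V'.sub_mem p.1.2 (hR' p.2)
      simp only [map_add]
      convert h using 1
      abel⟩⟩
  left_inv p := by ext <;> simp
  right_inv p := by ext <;> simp

variable [∀ x, IsTopologicalAddGroup (𝓕 x)] [∀ x, ContinuousSMul 𝕜 (𝓕 x)]

theorem IsMorphism.add_smul {L K : ∀ x, 𝓔 x →L[𝕜] 𝓕 x} (hL : IsMorphism E F L)
    (hK : IsMorphism E F K) (c : 𝕜) : IsMorphism E F fun x => L x + c • K x :=
  continuous_iff_continuousAt.2 fun _ => continuousAt_mk_add 𝕜 (F := E →L[𝕜] F)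
    (𝓕 := fun x => 𝓔 x →L[𝕜] 𝓕 x) (b := fun x => x) (Continuous.continuousAt hL)
      (continuousAt_mk_smul continuousAt_const (Continuous.continuousAt hK))

variable [∀ x, IsTopologicalAddGroup (𝓔 x)] [∀ x, ContinuousSMul 𝕜 (𝓔 x)]

theorem toKTheory_preimage_sub {L : ∀ x, 𝓔 x →L[𝕜] 𝓕 x} (hL : IsMorphism E F L)
    {V V' : ∀ x, Submodule 𝕜 (𝓕 x)} (hV : IsFinSubbundle F V) (hV' : IsFinSubbundle F V')
    (hN : IsFinSubbundle E (preimage L V)) (hN' : IsFinSubbundle E (preimage L V'))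
    {R R' : ∀ x, 𝓕 x →L[𝕜] 𝓔 x} (hR : IsMorphism F E R) (hR' : IsMorphism F E R')
    (hRV : ∀ x f, f - L x (R x f) ∈ V x) (hRV' : ∀ x f, f - L x (R' x f) ∈ V' x) :
    (subbundle E (preimage L V) hN).toKTheory - (subbundle F V hV).toKTheory =
      (subbundle E (preimage L V') hN').toKTheory - (subbundle F V' hV').toKTheory := by
  rw [sub_eq_sub_iff_add_eq_add, ← VectBundle.toKTheory_sum, ← VectBundle.toKTheory_sum]
  refine (VectBundle.iso_of_continuous (fun x => preimageProdEquiv (L x : 𝓔 x →ₗ[𝕜] 𝓕 x)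
    (V x) (V' x) (R x : 𝓕 x →ₗ[𝕜] 𝓔 x) (R' x : 𝓕 x →ₗ[𝕜] 𝓔 x) (hRV x) (hRV' x)) ?_).toKTheory_eq
  rw [isMorphism_iff] at hL hR hR'
  have h1 := (continuous_subbundle_coe hN).comp (VectBundle.continuous_sum_fst
    (subbundle E (preimage L V) hN) (subbundle F V' hV'))
  have h2 := (continuous_subbundle_coe hV').comp (VectBundle.continuous_sum_snd
    (subbundle E (preimage L V) hN) (subbundle F V' hV'))
  have h3 := fun p => continuousAt_mk_add 𝕜 (h1.continuousAt (x := p))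
    ((hR _).apply (h2.continuousAt (x := p)))
  have h4 := fun p => continuousAt_mk_sub 𝕜 ((hL _).apply (h3 p)) (h2.continuousAt (x := p))
  refine VectBundle.continuous_sum_mk _ _ ?_ ?_
  · refine continuous_subbundle_mk hN' (continuous_iff_continuousAt.2 fun p => ?_)
    exact continuousAt_mk_sub 𝕜 (h3 p) ((hR' _).apply (h4 p))
  · exact continuous_subbundle_mk hV (continuous_iff_continuousAt.2 fun p => h4 p)

/-- Near each point a Neumann series works for all `c` below the inverse of a local bound on `‖R
K‖`; compactness of `X` makes the bound uniform. Bijectivity does not depend on the trivialisation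
used to measure the norm. -/
theorem exists_forall_bijective_add_smul [CompactSpace X] [CompleteSpace E]
    {R : ∀ x, 𝓕 x →L[𝕜] 𝓔 x} {K : ∀ x, 𝓔 x →L[𝕜] 𝓕 x} (hR : IsMorphism F E R)
    (hK : IsMorphism E F K) :
    ∃ δ > 0, ∀ c : 𝕜, ‖c‖ < δ → ∀ x, Function.Bijective fun u : 𝓔 x => u + c • R x (K x u) := by
  have hloc : ∀ x₀ : X, x₀ ∈ Set.univ → ∃ t ∈ 𝓝[Set.univ] x₀, ∃ δ > 0, ∀ c : 𝕜, ‖c‖ < δ → ∀ x ∈ t,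
      Function.Bijective fun u : 𝓔 x => u + c • R x (K x u) := fun x₀ _ => by
    let e := trivializationAt E 𝓔 x₀
    let e' := trivializationAt F 𝓕 x₀
    have he : x₀ ∈ e.baseSet := FiberBundle.mem_baseSet_trivializationAt' _
    have he' : x₀ ∈ e'.baseSet := FiberBundle.mem_baseSet_trivializationAt' _
    let T : X → E →L[𝕜] E := fun x => (inTriv e' e (R x)).comp (inTriv e e' (K x))
    have hT : ContinuousAt T x₀ := ContinuousAt.clm_comp
      ((isMorphismAt_iff e' e he' he).1 (isMorphism_iff.1 hR x₀))
      ((isMorphismAt_iff e e' he he').1 (isMorphism_iff.1 hK x₀))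
    have hb : ∀ᶠ x in 𝓝 x₀, ‖T x‖ < ‖T x₀‖ + 1 := hT.norm.eventually_lt_const (lt_add_one _)
    refine ⟨_, mem_nhdsWithin_of_mem_nhds (Filter.Eventually.and hb
      (Filter.inter_mem (e.open_baseSet.mem_nhds he)
      (e'.open_baseSet.mem_nhds he'))), (‖T x₀‖ + 1)⁻¹, by positivity, ?_⟩
    rintro c hc x ⟨hx, hxe, hxe'⟩
    have hxe : x ∈ e.baseSet := hxe
    have hxe' : x ∈ e'.baseSet := hxe'
    have h1 : IsUnit (1 - (-c) • T x) := by
      refine isUnit_one_sub_of_norm_lt_one ?_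
      rw [norm_smul, norm_neg]
      have h0 : 0 < ‖T x₀‖ + 1 := by positivity
      calc ‖c‖ * ‖T x‖ ≤ ‖c‖ * (‖T x₀‖ + 1) := by gcongr
        _ < (‖T x₀‖ + 1)⁻¹ * (‖T x₀‖ + 1) := by gcongr
        _ = 1 := inv_mul_cancel₀ h0.ne'
    have h2 : Function.Bijective (1 - (-c) • T x : E →L[𝕜] E) :=
      (ContinuousLinearMap.isUnit_iff_bijective).1 h1
    let a := e.continuousLinearEquivAt 𝕜 x hxe
    have h3 : (fun u : 𝓔 x => u + c • R x (K x u)) =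
        a.symm ∘ (1 - (-c) • T x : E →L[𝕜] E) ∘ a := by
      ext u
      have h4 : T x (a u) = a (R x (K x u)) := by
        have ha : ∀ w, a w = e.continuousLinearMapAt 𝕜 x w := fun w =>
          (e.continuousLinearMapAt_apply_of_mem 𝕜 hxe w).symm
        simp only [ha, T, ContinuousLinearMap.comp_apply,
          inTriv_apply_continuousLinearMapAt e e' hxe,
          inTriv_apply_continuousLinearMapAt e' e hxe']
      simp [h4]
    rw [h3]
    exact a.symm.bijective.comp (h2.comp a.bijective)
  have := isCompact_univ.induction_on (p := fun S : Set X => ∃ δ > 0, ∀ c : 𝕜, ‖c‖ < δ → ∀ x ∈ S,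
      Function.Bijective fun u : 𝓔 x => u + c • R x (K x u)) ⟨1, one_pos, by simp⟩
    (fun s t hst ⟨δ, hδ, h⟩ => ⟨δ, hδ, fun c hc x hx => h c hc x (hst hx)⟩)
    (fun s t ⟨δ, hδ, h⟩ ⟨δ', hδ', h'⟩ => ⟨min δ δ', lt_min hδ hδ', fun c hc x hx =>
      hx.elim (h c (hc.trans_le (min_le_left _ _)) x) (h' c (hc.trans_le (min_le_right _ _)) x)⟩)
    hloc
  simpa using this

/-- The vectors `(L + cK)u` and `L(u + c R K u)` differ by `c(Ku - L R K u) ∈ V`, so one lies in `V`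
exactly when the other does. -/
theorem iso_preimage_add_smul {L L' K : ∀ x, 𝓔 x →L[𝕜] 𝓕 x} (hK : IsMorphism E F K)
    {V : ∀ x, Submodule 𝕜 (𝓕 x)} {c : 𝕜} (hL' : ∀ x, L' x = L x + c • K x)
    {R : ∀ x, 𝓕 x →L[𝕜] 𝓔 x} (hR : IsMorphism F E R)
    (hRV : ∀ x f, f - L x (R x f) ∈ V x)
    (hN : IsFinSubbundle E (preimage L V))
    (hN' : IsFinSubbundle E (preimage L' V))
    (hbij : ∀ x, Function.Bijective fun u : 𝓔 x => u + c • R x (K x u)) :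
    (subbundle E _ hN').Iso (subbundle E _ hN) := by
  obtain rfl : L' = fun x => L x + c • K x := funext hL'
  let A : ∀ x, 𝓔 x →ₗ[𝕜] 𝓔 x := fun x =>
    LinearMap.id + c • ((R x : 𝓕 x →ₗ[𝕜] 𝓔 x) ∘ₗ (K x : 𝓔 x →ₗ[𝕜] 𝓕 x))
  have hA : ∀ x u, A x u = u + c • R x (K x u) := fun x u => rfl
  have hmem : ∀ x u, A x u ∈ preimage L V x ↔ u ∈ preimage (fun x => L x + c • K x) V x := by
    intro x u
    change L x (A x u) ∈ V x ↔ (L x + c • K x) u ∈ V x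
    rw [← (V x).sub_mem_iff_left ((V x).smul_mem c (hRV x (K x u)))
      (x := (L x + c • K x) u), hA]
    have : (L x + c • K x) u - c • (K x u - L x (R x (K x u))) =
        L x (u + c • R x (K x u)) := by
      simp only [add_apply, smul_apply, map_add, map_smul, smul_sub]
      abel
    rw [this]
  have hmap : ∀ x, (preimage (fun x => L x + c • K x) V x).map
      (LinearEquiv.ofBijective (A x) (hbij x) : 𝓔 x →ₗ[𝕜] 𝓔 x) = preimage L V x := fun x => by
    ext w
    constructor
    · rintro ⟨u, hu, rfl⟩
      exact (hmem x u).2 hu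
    · intro hw
      obtain ⟨u, rfl⟩ := (hbij x).2 w
      exact ⟨u, (hmem x u).1 hw, rfl⟩
  refine VectBundle.iso_of_continuous (fun x =>
    (LinearEquiv.ofBijective (A x) (hbij x)).ofSubmodules
    _ _ (hmap x)) ?_
  refine continuous_subbundle_mk hN (continuous_iff_continuousAt.2 fun p => ?_)
  have h1 := (continuous_subbundle_coe hN').continuousAt (x := p)
  exact continuousAt_mk_add 𝕜 h1 (continuousAt_mk_smul continuousAt_const
    ((isMorphism_iff.1 hR _).apply ((isMorphism_iff.1 hK _).apply h1)))

end Swap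

/-! ### Subbundles transversal to the whole pencil `L + tK`. -/

/-- The vectors `v` span a complement of the range of `T + t • C`, for all `t ∈ [0, 1]`. -/
def IsPencilTransversal {𝕜 M N ι : Type*} [RCLike 𝕜]
    [AddCommGroup M] [Module 𝕜 M] [TopologicalSpace M]
    [AddCommGroup N] [Module 𝕜 N] [TopologicalSpace N] [IsTopologicalAddGroup N]
    [ContinuousSMul 𝕜 N] (T C : M →L[𝕜] N) (v : ι → N) : Prop :=
  ∀ t : unitInterval, (T + ((t : ℝ) : 𝕜) • C).range ⊔ Submodule.span 𝕜 (Set.range v) = ⊤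

theorem IsPencilTransversal.mono {𝕜 M N ι κ : Type*} [RCLike 𝕜]
    [AddCommGroup M] [Module 𝕜 M] [TopologicalSpace M]
    [AddCommGroup N] [Module 𝕜 N] [TopologicalSpace N] [IsTopologicalAddGroup N]
    [ContinuousSMul 𝕜 N] {T C : M →L[𝕜] N} {v : ι → N} {w : κ → N}
    (h : IsPencilTransversal T C v) (hvw : Set.range v ⊆ Submodule.span 𝕜 (Set.range w)) :
    IsPencilTransversal T C w := fun t =>
  top_le_iff.1 ((h t).ge.trans (sup_le_sup_left (Submodule.span_le.2 hvw) _))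

/-- For each `t` the condition is open jointly in `t` and the data; compactness of `[0, 1]` allows
one neighbourhood of the data for all `t`. -/
theorem isOpen_setOf_isPencilTransversal {𝕜 E F ι : Type*} [RCLike 𝕜] [NormedAddCommGroup E]
    [NormedSpace 𝕜 E] [CompleteSpace E] [NormedAddCommGroup F] [NormedSpace 𝕜 F] [CompleteSpace F]
    [Fintype ι] :
    IsOpen {p : (E →L[𝕜] F) × (E →L[𝕜] F) × (ι → F) |
      IsPencilTransversal p.1 p.2.1 p.2.2} := by
  refine isOpen_iff_mem_nhds.2 fun p hp => ?_
  have h := (isCompact_univ (X := unitInterval)).eventually_forall_of_forall_eventually (x₀ := p)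
    (P := fun q t => (q.1 + ((t : ℝ) : 𝕜) • q.2.1).range ⊔
      Submodule.span 𝕜 (Set.range q.2.2) = ⊤) fun t _ => by
    have hc : Continuous fun z : ((E →L[𝕜] F) × (E →L[𝕜] F) × (ι → F)) × unitInterval =>
        (z.1.1 + ((z.2 : ℝ) : 𝕜) • z.1.2.1, z.1.2.2) := by
      have : Continuous fun z : ((E →L[𝕜] F) × (E →L[𝕜] F) × (ι → F)) × unitInterval =>
        ((z.2 : ℝ) : 𝕜) :=
        RCLike.continuous_ofReal.comp (continuous_subtype_val.comp continuous_snd)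
      fun_prop
    exact (isOpen_setOf_transversal.preimage hc).mem_nhds (hp t)
  exact h.mono fun q hq t => hq t trivial

section TwoBundles

variable {𝕜 : Type*} [RCLike 𝕜] {X : Type v} [TopologicalSpace X]
  {E : Type*} [NormedAddCommGroup E] [NormedSpace 𝕜 E]
  {F : Type*} [NormedAddCommGroup F] [NormedSpace 𝕜 F]
  {𝓔 : X → Type u} [TopologicalSpace (TotalSpace E 𝓔)] [∀ x, AddCommGroup (𝓔 x)]
  [∀ x, Module 𝕜 (𝓔 x)] [∀ x, TopologicalSpace (𝓔 x)]
  [FiberBundle E 𝓔] [VectorBundle 𝕜 E 𝓔]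
  {𝓕 : X → Type u} [TopologicalSpace (TotalSpace F 𝓕)] [∀ x, AddCommGroup (𝓕 x)]
  [∀ x, Module 𝕜 (𝓕 x)] [∀ x, TopologicalSpace (𝓕 x)]
  [FiberBundle F 𝓕] [VectorBundle 𝕜 F 𝓕]

theorem continuousAt_mk_cutoff {χ : X → 𝕜} (hχ : Continuous χ) {U : Set X} (hχU : tsupport χ ⊆ U)
    {s : ∀ x, 𝓕 x} (hs : ∀ x ∈ U, ContinuousAt (fun y => TotalSpace.mk' F y (s y)) x) (x : X) :
    ContinuousAt (fun y => TotalSpace.mk' F y (χ y • s y)) x := by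
  by_cases hx : x ∈ U
  · exact continuousAt_mk_smul hχ.continuousAt (hs x hx)
  · refine (continuousAt_mk_zero 𝕜 (b := fun x => x) continuousAt_id).congr ?_
    filter_upwards [(isClosed_tsupport _).isOpen_compl.mem_nhds fun h => hx (hχU h)] with y hy
    rw [image_eq_zero_of_notMem_tsupport hy, zero_smul]

theorem exists_cutoff [CompactSpace X] [T2Space X] {x₀ : X} {U : Set X} (hU : U ∈ 𝓝 x₀) :
    ∃ (χ : X → 𝕜) (C : Set X), Continuous χ ∧ tsupport χ ⊆ U ∧ C ∈ 𝓝 x₀ ∧ IsClosed C ∧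
      (∀ x ∈ C, χ x = 1) ∧ ∀ x, ‖χ x‖ ≤ 1 := by
  obtain ⟨C, hC, hCc, hCU⟩ := exists_mem_nhds_isClosed_subset (interior_mem_nhds.2 hU)
  obtain ⟨f, hf, hf1, hf'⟩ := exists_tsupport_one_of_isOpen_isClosed isOpen_interior
    isClosed_closure.isCompact hCc hCU
  refine ⟨fun x => (f x : 𝕜), C, RCLike.continuous_ofReal.comp f.continuous,
    (closure_mono fun x hx => ?_).trans (hf.trans interior_subset), hC, hCc, fun x hx => ?_,
    fun x => ?_⟩
  · exact fun h => hx (by simp [h])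
  · simp [hf1 hx]
  · rw [RCLike.norm_ofReal, abs_of_nonneg (hf' x).1]
    exact (hf' x).2

theorem isFinSubbundle_top [FiniteDimensional 𝕜 F] :
    IsFinSubbundle F fun x => (⊤ : Submodule 𝕜 (𝓕 x)) := by
  refine isFinSubbundle_of_frames fun x₀ => ?_
  let e := trivializationAt F 𝓕 x₀
  let β := Module.finBasis 𝕜 F
  refine ⟨e.baseSet, e.open_baseSet, FiberBundle.mem_baseSet_trivializationAt' _, _,
    fun i x => e.symmL 𝕜 x (β i), fun i x hx => continuousAt_symmL_const e hx continuousAt_const,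
    fun x hx => ?_, fun x hx => ?_⟩
  · exact β.linearIndependent.map' (e.symmL 𝕜 x : F →ₗ[𝕜] 𝓕 x)
      (LinearMap.ker_eq_bot.2 (symmL_injective e hx))
  · have h1 : (fun i => e.symmL 𝕜 x (β i)) = (e.symmL 𝕜 x : F →ₗ[𝕜] 𝓕 x) ∘ β := rfl
    rw [h1, Set.range_comp, Submodule.span_image, β.span_eq, Submodule.map_top,
      LinearMap.range_eq_top]
    exact fun w => ⟨e.continuousLinearMapAt 𝕜 x w, e.symmL_continuousLinearMapAt hx w⟩

variable [∀ x, IsTopologicalAddGroup (𝓕 x)] [∀ x, ContinuousSMul 𝕜 (𝓕 x)]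

theorem isPencilTransversal_inTriv_iff (e : Trivialization E (π E 𝓔)) [MemTrivializationAtlas e]
    (e' : Trivialization F (π F 𝓕)) [MemTrivializationAtlas e'] {x : X} (h : x ∈ e.baseSet)
    (h' : x ∈ e'.baseSet) {ι : Type*} (T C : 𝓔 x →L[𝕜] 𝓕 x) (v : ι → 𝓕 x) :
    IsPencilTransversal (inTriv e e' T) (inTriv e e' C)
      (fun i => e'.continuousLinearMapAt 𝕜 x (v i)) ↔ IsPencilTransversal T C v := by
  refine forall_congr' fun t => ?_
  let a := e'.continuousLinearEquivAt 𝕜 x h'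
  have ha : ∀ w, a w = e'.continuousLinearMapAt 𝕜 x w := fun w =>
    (e'.continuousLinearMapAt_apply_of_mem 𝕜 h' w).symm
  rw [← Submodule.map_eq_top_iff (e := a.toLinearEquiv), Submodule.map_sup, ← Submodule.span_image,
    ← Set.range_comp]
  have h1 : (fun i => e'.continuousLinearMapAt 𝕜 x (v i)) = a.toLinearEquiv ∘ v :=
    funext fun i => (ha _).symm
  have h2 : (inTriv e e' T + ((t : ℝ) : 𝕜) • inTriv e e' C).range =
      (T + ((t : ℝ) : 𝕜) • C).range.map (a.toLinearEquiv : 𝓕 x →ₗ[𝕜] F) := by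
    ext f
    constructor
    · rintro ⟨u, rfl⟩
      refine ⟨_, ⟨e.symmL 𝕜 x u, rfl⟩, ?_⟩
      refine (ha _).trans ?_
      simp [inTriv]
    · rintro ⟨_, ⟨u, rfl⟩, rfl⟩
      refine ⟨e.continuousLinearMapAt 𝕜 x u, ?_⟩
      refine Eq.trans ?_ (ha _).symm
      simp only [ContinuousLinearMap.coe_coe, add_apply, smul_apply, map_add, map_smul,
        inTriv_apply_continuousLinearMapAt e e' h]
  rw [h1, h2]
  rfl

variable [CompleteSpace E] [CompleteSpace F]

/-- A finite set spanning a complement of the range at `t₀` remains transversal for `t` near `t₀`,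
and finitely many such sets cover `[0, 1]`. -/
theorem exists_isPencilTransversal (e : Trivialization E (π E 𝓔)) [MemTrivializationAtlas e]
    (e' : Trivialization F (π F 𝓕)) [MemTrivializationAtlas e'] {x : X} (he : x ∈ e.baseSet)
    (he' : x ∈ e'.baseSet) {T C : 𝓔 x →L[𝕜] 𝓕 x}
    (h : ∀ t : unitInterval, (T + ((t : ℝ) : 𝕜) • C).IsFredholm) :
    ∃ A : Set (𝓕 x), A.Finite ∧ IsPencilTransversal T C ((↑) : A → 𝓕 x) := by
  have key := isCompact_univ.induction_on (p := fun S : Set unitInterval =>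
      ∃ A : Set (𝓕 x), A.Finite ∧
        ∀ t ∈ S, (T + ((t : ℝ) : 𝕜) • C).range ⊔ Submodule.span 𝕜 A = ⊤)
    ⟨∅, Set.finite_empty, by simp⟩
    (fun s t hst ⟨A, hA, h⟩ => ⟨A, hA, fun r hr => h r (hst hr)⟩)
    (fun s t ⟨A, hA, h⟩ ⟨A', hA', h'⟩ => ⟨A ∪ A', hA.union hA', fun r hr => by
      rw [Submodule.span_union, eq_top_iff]
      rcases hr with hr | hr
      · exact (h r hr).ge.trans (sup_le_sup_left le_sup_left _)
      · exact (h' r hr).ge.trans (sup_le_sup_left le_sup_right _)⟩) ?_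
  · obtain ⟨A, hA, h⟩ := key
    exact ⟨A, hA, fun t => by rw [Subtype.range_coe]; exact h t trivial⟩
  intro t₀ _
  obtain ⟨D, hD⟩ := (T + ((t₀ : ℝ) : 𝕜) • C).range.exists_isCompl
  obtain ⟨A, rfl⟩ := (h t₀).finite_coker.fg_of_isCompl hD
  refine ⟨{t | (T + ((t : ℝ) : 𝕜) • C).range ⊔ Submodule.span 𝕜 (A : Set (𝓕 x)) = ⊤},
    mem_nhdsWithin_of_mem_nhds ?_, A, A.finite_toSet, fun t ht => ht⟩
  have hc : Continuous fun t : unitInterval => (inTriv e e' (T + ((t : ℝ) : 𝕜) • C),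
      fun i : A => e'.continuousLinearMapAt 𝕜 x (i : 𝓕 x)) := by
    have : Continuous fun t : unitInterval => ((t : ℝ) : 𝕜) :=
      RCLike.continuous_ofReal.comp continuous_subtype_val
    have h2 : (fun t : unitInterval => inTriv e e' (T + ((t : ℝ) : 𝕜) • C)) =
        fun t : unitInterval => inTriv e e' T + ((t : ℝ) : 𝕜) • inTriv e e' C := by
      ext t u
      simp [inTriv]
    refine Continuous.prodMk ?_ continuous_const
    rw [h2]
    fun_prop
  have h0 : ∀ S : 𝓔 x →L[𝕜] 𝓕 x, S.range ⊔ Submodule.span 𝕜 (A : Set (𝓕 x)) = ⊤ ↔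
      (inTriv e e' S).range ⊔ Submodule.span 𝕜
        (Set.range fun i : A => e'.continuousLinearMapAt 𝕜 x (i : 𝓕 x)) = ⊤ := fun S => by
    -- With second operator `0` the pencil is constant, so the statement about pencils covers a
    -- single operator.
    have := isPencilTransversal_inTriv_iff e e' he he' S 0 ((↑) : A → 𝓕 x)
    simpa [IsPencilTransversal, inTriv] using this.symm
  simp only [h0]
  exact (isOpen_setOf_transversal.preimage hc).mem_nhds ((h0 _).1 hD.sup_eq_top)

theorem exists_sections_isPencilTransversal [CompactSpace X] [T2Space X]
    {L K : ∀ x, 𝓔 x →L[𝕜] 𝓕 x} (hL : IsMorphism E F L) (hK : IsMorphism E F K)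
    (h : ∀ x, ∀ t : unitInterval, (L x + ((t : ℝ) : 𝕜) • K x).IsFredholm) :
    ∃ (n : ℕ) (s : Fin n → ∀ x, 𝓕 x),
      (∀ i x, ContinuousAt (fun y => TotalSpace.mk' F y (s i y)) x) ∧
      ∀ x, IsPencilTransversal (L x) (K x) fun i => s i x := by
  -- The index types are built from finite subsets of fibres, which live in `Type u`, and from their
  -- disjoint sums; only at the end are they renumbered by `Fin n`.
  suffices key : ∃ (ι : Type u) (_ : Fintype ι) (s : ι → ∀ x, 𝓕 x),
      (∀ i x, ContinuousAt (fun y => TotalSpace.mk' F y (s i y)) x) ∧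
      ∀ x ∈ Set.univ, IsPencilTransversal (L x) (K x) fun i => s i x by
    obtain ⟨ι, _, s, hs, hs'⟩ := key
    let σ := Fintype.equivFin ι
    refine ⟨_, fun i => s (σ.symm i), fun i => hs _, fun x => (hs' x trivial).mono ?_⟩
    rintro _ ⟨i, rfl⟩
    exact Submodule.subset_span ⟨σ i, by simp⟩
  refine isCompact_univ.induction_on (p := fun S => ∃ (ι : Type u) (_ : Fintype ι)
      (s : ι → ∀ x, 𝓕 x), (∀ i x, ContinuousAt (fun y => TotalSpace.mk' F y (s i y)) x) ∧
      ∀ x ∈ S, IsPencilTransversal (L x) (K x) fun i => s i x)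
    ⟨PEmpty, inferInstance, fun i => i.elim, fun i => i.elim, by simp⟩
    (fun S T hST ⟨ι, hι, s, hs, h⟩ => ⟨ι, hι, s, hs, fun x hx => h x (hST hx)⟩) ?_ fun x₀ _ => ?_
  · rintro S T ⟨ι, hι, s, hs, h⟩ ⟨κ, hκ, t, ht, h'⟩
    refine ⟨ι ⊕ κ, inferInstance, Sum.elim s t, fun i => i.casesOn hs ht, fun x hx => ?_⟩
    rcases hx with hx | hx
    · refine (h x hx).mono ?_
      rintro _ ⟨i, rfl⟩
      exact Submodule.subset_span ⟨.inl i, rfl⟩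
    · refine (h' x hx).mono ?_
      rintro _ ⟨i, rfl⟩
      exact Submodule.subset_span ⟨.inr i, rfl⟩
  · let e := trivializationAt E 𝓔 x₀
    let e' := trivializationAt F 𝓕 x₀
    have he : x₀ ∈ e.baseSet := FiberBundle.mem_baseSet_trivializationAt' _
    have he' : x₀ ∈ e'.baseSet := FiberBundle.mem_baseSet_trivializationAt' _
    obtain ⟨A, hA, hAt⟩ := exists_isPencilTransversal e e' he he' (h x₀)
    let _ := hA.fintype
    let τ : A → F := fun i => e'.continuousLinearMapAt 𝕜 x₀ (i : 𝓕 x₀)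
    have hc : ContinuousAt (fun x => (inTriv e e' (L x), inTriv e e' (K x), τ)) x₀ :=
      ((isMorphismAt_iff e e' he he').1 (isMorphism_iff.1 hL x₀)).prodMk
        (((isMorphismAt_iff e e' he he').1 (isMorphism_iff.1 hK x₀)).prodMk continuousAt_const)
    have hW := hc.preimage_mem_nhds (isOpen_setOf_isPencilTransversal.mem_nhds
      ((isPencilTransversal_inTriv_iff e e' he he' _ _ _).2 hAt))
    obtain ⟨χ, C, hχ, hχU, hC, -, hχC, -⟩ := exists_cutoff (𝕜 := 𝕜) (Filter.inter_mem
      (e.open_baseSet.mem_nhds he) (e'.open_baseSet.mem_nhds he'))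
    -- The sections are constant in the trivialisation and cut off by `χ`. Where `χ = 1` they have
    -- the constant value `τ`, which stays transversal near `x₀` by openness.
    refine ⟨_, mem_nhdsWithin_of_mem_nhds (Filter.inter_mem hW (Filter.inter_mem hC
      (Filter.inter_mem (e.open_baseSet.mem_nhds he) (e'.open_baseSet.mem_nhds he')))), A,
      inferInstance, fun i x => χ x • e'.symmL 𝕜 x (τ i), fun i => continuousAt_mk_cutoff hχ hχU
        fun x hx => continuousAt_symmL_const e' hx.2 continuousAt_const, ?_⟩
    rintro x ⟨hx, hxC, hxe, hxe'⟩
    rw [← isPencilTransversal_inTriv_iff e e' hxe hxe']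
    have hx' : IsPencilTransversal (inTriv e e' (L x)) (inTriv e e' (K x)) τ := hx
    convert hx' using 2 with i
    change e'.continuousLinearMapAt 𝕜 x (χ x • e'.symmL 𝕜 x (τ i)) = τ i
    rw [hχC x hxC, one_smul, e'.continuousLinearMapAt_symmL hxe']

/-- The sections are corrected one small closed set at a time. Each correction is supported in a
trivialising set and small enough to preserve both transversality and the independence already
achieved, since both are open conditions holding on compact sets. -/
theorem exists_sections_linearIndependent [CompactSpace X] [T2Space X]
    (hF : ¬ FiniteDimensional 𝕜 F) {L K : ∀ x, 𝓔 x →L[𝕜] 𝓕 x} (hL : IsMorphism E F L)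
    (hK : IsMorphism E F K) {ι : Type*} [Fintype ι] {s : ι → ∀ x, 𝓕 x}
    (hs : ∀ i x, ContinuousAt (fun y => TotalSpace.mk' F y (s i y)) x)
    (hsT : ∀ x, IsPencilTransversal (L x) (K x) fun i => s i x) :
    ∃ s : ι → ∀ x, 𝓕 x, (∀ i x, ContinuousAt (fun y => TotalSpace.mk' F y (s i y)) x) ∧
      (∀ x, IsPencilTransversal (L x) (K x) fun i => s i x) ∧
      ∀ x, LinearIndependent 𝕜 fun i => s i x := by
  -- Quantifying over every closed `A` and every family that is already independent on `A` lets the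
  -- corrections for two sets be chained. Closures are used because the sets of the induction need
  -- not be closed.
  have key := isCompact_univ.induction_on (p := fun S : Set X => ∀ A, IsClosed A →
    ∀ s : ι → ∀ x, 𝓕 x, (∀ i x, ContinuousAt (fun y => TotalSpace.mk' F y (s i y)) x) →
      (∀ x, IsPencilTransversal (L x) (K x) fun i => s i x) →
      (∀ x ∈ A, LinearIndependent 𝕜 fun i => s i x) →
      ∃ s : ι → ∀ x, 𝓕 x, (∀ i x, ContinuousAt (fun y => TotalSpace.mk' F y (s i y)) x) ∧
        (∀ x, IsPencilTransversal (L x) (K x) fun i => s i x) ∧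
        ∀ x ∈ A ∪ closure S, LinearIndependent 𝕜 fun i => s i x)
    (fun A hA s hs hsT hsA => ⟨s, hs, hsT, by simpa using hsA⟩)
    (fun S T hST h A hA s hs hsT hsA => by
      obtain ⟨s', h1, h2, h3⟩ := h A hA s hs hsT hsA
      exact ⟨s', h1, h2, fun x hx => h3 x (Set.union_subset_union_right _ (closure_mono hST) hx)⟩)
    (fun S T hS hT A hA s hs hsT hsA => by
      obtain ⟨s', h1, h2, h3⟩ := hS A hA s hs hsT hsA
      obtain ⟨s'', h4, h5, h6⟩ := hT _ (hA.union isClosed_closure) s' h1 h2 h3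
      exact ⟨s'', h4, h5, fun x hx => h6 x (by rwa [closure_union, ← Set.union_assoc] at hx)⟩) ?_
  · obtain ⟨s', h1, h2, h3⟩ := key ∅ isClosed_empty s hs hsT (by simp)
    exact ⟨s', h1, h2, fun x => h3 x (by simp)⟩
  intro x₀ _
  let e := trivializationAt E 𝓔 x₀
  let e' := trivializationAt F 𝓕 x₀
  let U := e.baseSet ∩ e'.baseSet
  have hUo : IsOpen U := e.open_baseSet.inter e'.open_baseSet
  have hxU : x₀ ∈ U := ⟨FiberBundle.mem_baseSet_trivializationAt' _,
    FiberBundle.mem_baseSet_trivializationAt' _⟩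
  obtain ⟨χ, C, hχ, hχU, hC, hCc, hχC, hχ1⟩ := exists_cutoff (𝕜 := 𝕜) (hUo.mem_nhds hxU)
  refine ⟨C, mem_nhdsWithin_of_mem_nhds hC, fun A hA s hs hsT hsA => ?_⟩
  rw [hCc.closure_eq]
  let f : X → ι → F := fun x i => e'.continuousLinearMapAt 𝕜 x (s i x)
  have hf : ContinuousOn f U := fun x hx => ContinuousAt.continuousWithinAt <|
    continuousAt_pi.2 fun i => ((continuousAt_mk_iff 𝕜 e' (b := fun x => x) hx.2).1 (hs i x)).2
  let Φ : X → (E →L[𝕜] F) × (E →L[𝕜] F) × (ι → F) := fun x =>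
    (inTriv e e' (L x), inTriv e e' (K x), f x)
  have hΦ : ContinuousOn Φ U := ContinuousOn.prodMk
    (fun x hx => ((isMorphismAt_iff e e' hx.1 hx.2).1 (isMorphism_iff.1 hL x)).continuousWithinAt)
    (ContinuousOn.prodMk (fun x hx => ((isMorphismAt_iff e e' hx.1 hx.2).1
      (isMorphism_iff.1 hK x)).continuousWithinAt) hf)
  let B := tsupport χ
  have hB : IsClosed B := isClosed_tsupport χ
  -- `δ` protects transversality over the support `B` of the cutoff; `δ'` below protects
  -- independence over `A ∩ B`.
  obtain ⟨δ, hδ, hδT⟩ := (hB.isCompact.image_of_continuousOn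
    (hΦ.mono hχU)).exists_thickening_subset_open
      (isOpen_setOf_isPencilTransversal (𝕜 := 𝕜) (E := E) (F := F) (ι := ι)) (by
        rintro _ ⟨x, hx, rfl⟩
        exact (isPencilTransversal_inTriv_iff e e' (hχU hx).1 (hχU hx).2 _ _ _).2 (hsT x))
  obtain ⟨δ', hδ', hδI⟩ := ((hA.inter hB).isCompact.image_of_continuousOn
    (hf.mono (Set.inter_subset_right.trans hχU))).exists_thickening_subset_open
      (isOpen_setOfPred_linearIndependent (𝕜 := 𝕜) (E := F) (ι := ι)) (by
        rintro _ ⟨x, ⟨hxA, hx⟩, rfl⟩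
        exact (hsA x hxA).map' (e'.continuousLinearMapAt 𝕜 x : 𝓕 x →ₗ[𝕜] F)
          (LinearMap.ker_eq_bot.2 (continuousLinearMapAt_injective e' (hχU hx).2)))
  obtain ⟨g, hg, hgf, hgi⟩ := exists_approx_linearIndependent (𝕜 := 𝕜) hF hUo hB hχU hf
    (lt_min hδ hδ')
  -- In the trivialisation this is `f + χ (g - f)`: it equals the independent family `g` on `C`, and
  -- the original family off `B`.
  let s' : ι → ∀ x, 𝓕 x := fun i x => s i x + χ x • e'.symmL 𝕜 x (g x i - f x i)
  have htriv : ∀ x ∈ B, (fun i => e'.continuousLinearMapAt 𝕜 x (s' i x)) =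
      f x + χ x • (g x - f x) := fun x hx => by
    ext i
    simp only [s', map_add, map_smul, e'.continuousLinearMapAt_symmL (hχU hx).2]
    rfl
  have hdist : ∀ x ∈ B, dist (f x + χ x • (g x - f x)) (f x) < min δ δ' := fun x hx => by
    rw [dist_eq_norm, add_sub_cancel_left, norm_smul]
    exact (mul_le_of_le_one_left (norm_nonneg _) (hχ1 x)).trans_lt (hgf x hx)
  have hout : ∀ x, x ∉ B → (fun i => s' i x) = fun i => s i x := fun x hx => by
    ext i
    simp [s', image_eq_zero_of_notMem_tsupport hx]
  have hinj : ∀ x ∈ B, LinearIndependent 𝕜 (f x + χ x • (g x - f x)) →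
      LinearIndependent 𝕜 fun i => s' i x := fun x hx h => by
    rw [← htriv x hx] at h
    exact LinearIndependent.of_comp (e'.continuousLinearMapAt 𝕜 x : 𝓕 x →ₗ[𝕜] F) h
  refine ⟨s', fun i x => ?_, fun x => ?_, fun x hx => ?_⟩
  · refine continuousAt_mk_add 𝕜 (hs i x) (continuousAt_mk_cutoff hχ hχU (fun y hy => ?_) x)
    refine continuousAt_symmL_const e' hy.2 ?_
    exact ((continuous_apply i).comp hg).continuousAt.sub
      (continuousAt_pi.1 (hf.continuousAt (hUo.mem_nhds hy)) i)
  · by_cases hx : x ∈ B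
    · rw [← isPencilTransversal_inTriv_iff e e' (hχU hx).1 (hχU hx).2, htriv x hx]
      refine hδT (a := (inTriv e e' (L x), inTriv e e' (K x), f x + χ x • (g x - f x)))
        (Metric.mem_thickening_iff.2 ⟨Φ x, ⟨x, hx, rfl⟩, ?_⟩)
      simpa [Φ, Prod.dist_eq, hδ] using (hdist x hx).trans_le (min_le_left _ _)
    · rw [hout x hx]
      exact hsT x
  · by_cases hxB : x ∈ B
    · refine hinj x hxB ?_
      rcases hx with hx | hx
      · exact hδI (Metric.mem_thickening_iff.2 ⟨f x, ⟨x, ⟨hx, hxB⟩, rfl⟩,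
          (hdist x hxB).trans_le (min_le_right _ _)⟩)
      · rw [hχC x hx, one_smul, add_sub_cancel]
        exact hgi x
    · rw [hout x hxB]
      rcases hx with hx | hx
      · exact hsA x hx
      · exact absurd (subset_tsupport _ (by simp [hχC x hx])) hxB

theorem exists_isTransversal_add_smul [CompactSpace X] [T2Space X]
    {L K : ∀ x, 𝓔 x →L[𝕜] 𝓕 x} (hL : IsMorphism E F L) (hK : IsMorphism E F K)
    (h : ∀ x, ∀ t : unitInterval, (L x + ((t : ℝ) : 𝕜) • K x).IsFredholm) :
    ∃ V : ∀ x, Submodule 𝕜 (𝓕 x), ∀ t : unitInterval,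
      IsTransversal F (fun x => L x + ((t : ℝ) : 𝕜) • K x) V := by
  -- The sections may outnumber the rank of a finite-dimensional bundle, so they can be made
  -- independent only in infinite dimensions; otherwise the whole bundle serves as `V`.
  by_cases hF : FiniteDimensional 𝕜 F
  · exact ⟨fun x => ⊤, fun t => ⟨isFinSubbundle_top, fun x => sup_top_eq _⟩⟩
  · obtain ⟨n, s, hs, hsT⟩ := exists_sections_isPencilTransversal hL hK h
    obtain ⟨s, hs, hsT, hsI⟩ := exists_sections_linearIndependent hF hL hK hs hsT
    refine ⟨fun x => Submodule.span 𝕜 (Set.range fun i => s i x), fun t =>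
      ⟨isFinSubbundle_of_frames fun x₀ => ?_, fun x => hsT x t⟩⟩
    exact ⟨Set.univ, isOpen_univ, trivial, n, s, fun i x _ => hs i x, fun x _ => hsI x,
      fun x _ => rfl⟩

end TwoBundles

/-! ### Homotopy invariance and existence of the index bundle. -/

section IndexBundles

variable {𝕜 : Type*} [RCLike 𝕜] {X : Type v} [TopologicalSpace X] [CompactSpace X] [T2Space X]
  {E : Type*} [NormedAddCommGroup E] [NormedSpace 𝕜 E] [CompleteSpace E]
  {F : Type*} [NormedAddCommGroup F] [NormedSpace 𝕜 F] [CompleteSpace F]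
  {𝓔 : X → Type u} [TopologicalSpace (TotalSpace E 𝓔)] [∀ x, AddCommGroup (𝓔 x)]
  [∀ x, Module 𝕜 (𝓔 x)] [∀ x, TopologicalSpace (𝓔 x)]
  [FiberBundle E 𝓔] [VectorBundle 𝕜 E 𝓔]
  {𝓕 : X → Type u} [TopologicalSpace (TotalSpace F 𝓕)] [∀ x, AddCommGroup (𝓕 x)]
  [∀ x, Module 𝕜 (𝓕 x)] [∀ x, TopologicalSpace (𝓕 x)]
  [FiberBundle F 𝓕] [VectorBundle 𝕜 F 𝓕]
  [∀ x, IsTopologicalAddGroup (𝓔 x)] [∀ x, ContinuousSMul 𝕜 (𝓔 x)]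
  [∀ x, IsTopologicalAddGroup (𝓕 x)] [∀ x, ContinuousSMul 𝕜 (𝓕 x)]

theorem iso_preimage_of_homotopy {L K : ∀ x, 𝓔 x →L[𝕜] 𝓕 x} (hL : IsMorphism E F L)
    (hK : IsMorphism E F K)
    (hfd : ∀ (t : unitInterval) x, FiniteDimensional 𝕜 (L x + ((t : ℝ) : 𝕜) • K x).ker)
    {V : ∀ x, Submodule 𝕜 (𝓕 x)}
    (hV : ∀ t : unitInterval, IsTransversal F (fun x => L x + ((t : ℝ) : 𝕜) • K x) V)
    (s t : unitInterval) :
    (subbundle E _ (isFinSubbundle_preimage (hL.add_smul hK _) (hfd s) (hV s))).Iso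
      (subbundle E _ (isFinSubbundle_preimage (hL.add_smul hK _) (hfd t) (hV t))) := by
  have hN := fun t : unitInterval =>
    isFinSubbundle_preimage (hL.add_smul hK ((t : ℝ) : 𝕜)) (hfd t) (hV t)
  -- Being isomorphic is transitive and, by the perturbation lemma, holds in both directions for
  -- parameters close to a given `t`; connectedness of `[0, 1]` does the rest.
  refine isPreconnected_univ.induction₂' (fun s t : unitInterval =>
    (subbundle E _ (hN s)).Iso (subbundle E _ (hN t))) (fun t _ => ?_)
    (fun _ _ _ _ _ _ h h' => h.trans h') (Set.mem_univ s) (Set.mem_univ t)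
  obtain ⟨R, hR, hRV⟩ := exists_inverse_mod (hL.add_smul hK ((t : ℝ) : 𝕜)) (hfd t) (hV t)
  obtain ⟨δ, hδ, hbij⟩ := exists_forall_bijective_add_smul hR hK
  refine eventually_nhdsWithin_of_eventually_nhds ?_
  filter_upwards [Metric.ball_mem_nhds t hδ] with s hs
  have h : (subbundle E _ (hN s)).Iso (subbundle E _ (hN t)) := by
    refine iso_preimage_add_smul hK (c := ((s : ℝ) : 𝕜) - ((t : ℝ) : 𝕜)) (fun x => ?_) hR hRV
      (hN t) (hN s) (hbij _ ?_)
    · rw [sub_smul]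
      abel
    · rw [← RCLike.ofReal_sub, RCLike.norm_ofReal, ← Real.dist_eq]
      exact hs
  exact ⟨h.symm, h⟩

theorem isIndexBundle_of_isTransversal {L : ∀ x, 𝓔 x →L[𝕜] 𝓕 x} (hL : IsMorphism E F L)
    (hfd : ∀ x, FiniteDimensional 𝕜 (L x).ker) {V : ∀ x, Submodule 𝕜 (𝓕 x)}
    (hV : IsTransversal F L V) :
    IsIndexBundle E F L ((subbundle E _ (isFinSubbundle_preimage hL hfd hV)).toKTheory -
      (subbundle F V hV.1).toKTheory) := by
  refine ⟨⟨V, hV⟩, fun V' hV' => ⟨isFinSubbundle_preimage hL hfd hV', ?_⟩⟩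
  obtain ⟨R, hR, hRV⟩ := exists_inverse_mod hL hfd hV
  obtain ⟨R', hR', hRV'⟩ := exists_inverse_mod hL hfd hV'
  exact toKTheory_preimage_sub hL hV.1 hV'.1 _ _ hR hR' hRV hRV'

/-- `ind` is a choice, so existence of a class with the defining property suffices. Evaluating that
property at any one transversal `V` then computes it, as in `ind_eq`. -/
theorem isIndexBundle_ind {L : ∀ x, 𝓔 x →L[𝕜] 𝓕 x} (hL : IsMorphism E F L)
    (hfd : ∀ x, FiniteDimensional 𝕜 (L x).ker) {V : ∀ x, Submodule 𝕜 (𝓕 x)}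
    (hV : IsTransversal F L V) : IsIndexBundle E F L (ind E F L) :=
  Classical.epsilon_spec ⟨_, isIndexBundle_of_isTransversal hL hfd hV⟩

theorem ind_eq {L : ∀ x, 𝓔 x →L[𝕜] 𝓕 x} (hL : IsMorphism E F L)
    (hfd : ∀ x, FiniteDimensional 𝕜 (L x).ker) {V : ∀ x, Submodule 𝕜 (𝓕 x)}
    (hV : IsTransversal F L V) :
    ind E F L = (subbundle E _ (isFinSubbundle_preimage hL hfd hV)).toKTheory -
      (subbundle F V hV.1).toKTheory :=
  ((isIndexBundle_ind hL hfd hV).2 V hV).2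

end IndexBundles

theorem IsFinSubbundle.finiteDimensional {𝕜 : Type*} [RCLike 𝕜] {X : Type v} [TopologicalSpace X]
    {F : Type*} {𝓕 : X → Type u} [TopologicalSpace (TotalSpace F 𝓕)] [∀ x, AddCommGroup (𝓕 x)]
    [∀ x, Module 𝕜 (𝓕 x)] {V : ∀ x, Submodule 𝕜 (𝓕 x)} (hV : IsFinSubbundle F V) (x : X) :
    FiniteDimensional 𝕜 (V x) := by
  obtain ⟨U, -, hx, n, s, hs⟩ := exists_isFrameOn hV x
  rw [← hs.span_eq x hx]
  exact FiniteDimensional.span_of_finite 𝕜 (Set.finite_range _)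

end IndexBundle

end

/-- Let `𝓔`, `𝓕` be Banach bundles over a compact Hausdorff space `X`, let `L` be a Fredholm morphism
and `K` a morphism that is compact in every fibre. Then `L + K` is a Fredholm morphism, the index
bundles of `L` and `L + K` are well-defined, and they agree in `K(X)`. -/
theorem mainTheorem7 {𝕜 : Type*} [RCLike 𝕜]
    {X : Type v} [TopologicalSpace X] [CompactSpace X] [T2Space X]
    {E : Type*} [NormedAddCommGroup E] [NormedSpace 𝕜 E] [CompleteSpace E]
    {F : Type*} [NormedAddCommGroup F] [NormedSpace 𝕜 F] [CompleteSpace F]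
    {𝓔 : X → Type u} [TopologicalSpace (Bundle.TotalSpace E 𝓔)] [∀ x, AddCommGroup (𝓔 x)]
    [∀ x, Module 𝕜 (𝓔 x)] [∀ x, TopologicalSpace (𝓔 x)]
    [FiberBundle E 𝓔] [VectorBundle 𝕜 E 𝓔]
    {𝓕 : X → Type u} [TopologicalSpace (Bundle.TotalSpace F 𝓕)] [∀ x, AddCommGroup (𝓕 x)]
    [∀ x, Module 𝕜 (𝓕 x)] [∀ x, TopologicalSpace (𝓕 x)]
    [∀ x, IsTopologicalAddGroup (𝓕 x)] [∀ x, ContinuousSMul 𝕜 (𝓕 x)]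
    [FiberBundle F 𝓕] [VectorBundle 𝕜 F 𝓕]
    (L : ∀ x, 𝓔 x →L[𝕜] 𝓕 x) (hL : IndexBundle.IsFredholmMorphism E F L)
    (K : ∀ x, 𝓔 x →L[𝕜] 𝓕 x) (hK : IndexBundle.IsMorphism E F K)
    (hKc : ∀ x, IsCompactOperator (K x)) :
    IndexBundle.IsFredholmMorphism E F (L + K) ∧
      IndexBundle.IsIndexBundle E F L (IndexBundle.ind E F L) ∧
      IndexBundle.IsIndexBundle E F (L + K) (IndexBundle.ind E F (L + K)) ∧
      IndexBundle.ind E F (L + K) = IndexBundle.ind E F L := by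
  obtain ⟨hLm, k, hLk⟩ := hL
  have := IndexBundle.isTopologicalAddGroup_fibre 𝕜 E 𝓔
  have := IndexBundle.continuousSMul_fibre 𝕜 E 𝓔
  have := IndexBundle.t2Space_fibre 𝕜 E 𝓔
  have := IndexBundle.t2Space_fibre 𝕜 F 𝓕
  have hfr : ∀ x, ∀ t : unitInterval, (L x + ((t : ℝ) : 𝕜) • K x).IsFredholm := fun x t =>
    IndexBundle.isFredholm_add_of_isCompactOperator (IndexBundle.fibreEquiv 𝕜 E 𝓔 x)
      (IndexBundle.fibreEquiv 𝕜 F 𝓕 x) (hLk x).1 ((hKc x).smul _)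
  obtain ⟨V, hV⟩ := IndexBundle.exists_isTransversal_add_smul hLm hK hfr
  -- The endpoints `t = 1` and `t = 0` are `L + K` and `L`. This one isomorphism gives the equality
  -- of index bundles and, through fibre dimensions, that of the numerical indices.
  have hiso := IndexBundle.iso_preimage_of_homotopy hLm hK (fun t x => (hfr x t).finite_ker) hV 1 0
  have hm1 := hLm.add_smul hK (((1 : unitInterval) : ℝ) : 𝕜)
  have h0 : (fun x => L x + (((0 : unitInterval) : ℝ) : 𝕜) • K x) = L := by
    ext x u
    simp
  have h1 : (fun x => L x + (((1 : unitInterval) : ℝ) : 𝕜) • K x) = L + K := by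
    ext x u
    simp
  have hV0 := hV 0
  have hV1 := hV 1
  have hfr1 : ∀ x, ((L + K) x).IsFredholm := fun x => by
    have := hfr x 1
    rwa [congrFun h1 x] at this
  simp only [h0, h1] at hV0 hV1 hm1 hiso
  have hker0 := fun x => (hLk x).1.finite_ker
  have hker1 := fun x => (hfr1 x).finite_ker
  refine ⟨⟨hm1, k, fun x => ⟨hfr1 x, ?_⟩⟩, IndexBundle.isIndexBundle_ind hLm hker0 hV0,
    IndexBundle.isIndexBundle_ind hm1 hker1 hV1, ?_⟩
  -- In each fibre the index is `dim E(L, V) - dim V`, with the same `V` for both operators.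
  · have := hV0.1.finiteDimensional x
    obtain ⟨φ, -, -⟩ := hiso
    rw [← (hLk x).2, IndexBundle.fredholmIndex_eq _ (V x) (hker1 x) (hV1.2 x),
      IndexBundle.fredholmIndex_eq _ (V x) (hker0 x) (hV0.2 x)]
    congr 2
    exact (φ x).finrank_eq
  · rw [IndexBundle.ind_eq hm1 hker1 hV1, IndexBundle.ind_eq hLm hker0 hV0, hiso.toKTheory_eq]
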